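/- Let $a,b$ be positive integers with $ab>4$, let $\mathfrak g$ be the hyperbolic Kac–Moody algebra of rank $2$ with generalized Cartan matrix $A=(\langle\alpha_j,\alpha_i^\vee\rangle)_{i,j}=\begin{pmatrix}2&-a\\-b&2\end{pmatrix}$, with simple roots $\alpha_1,\alpha_2$, simple coroots $\alpha_1^\vee,\alpha_2^\vee$, fundamental weights $\Lambda_1,\Lambda_2$ ($\langle\Lambda_i,\alpha_j^\vee\rangle=\delta_{ij}$), weight lattice $P=\mathbb Z\Lambda_1\oplus\mathbb Z\Lambda_2$, and Weyl group $W=\langle r_1,r_2\rangle$. For a real root $\beta=w\alpha_i$ put $\beta^\vee=w\alpha_i^\vee$ and $r_\beta(\mu)=\mu-\langle\mu,\beta^\vee\rangle\beta$. Let $\lambda\in P$. For $\mu,\nu\in W\lambda$ write $\mu\ge\nu$ if there are $\mu=\mu_0,\mu_1,\dots,\mu_r=\nu$ in $W\lambda$ and positive real roots $\beta_1,\dots,\beta_r$ with $\mu_k=r_{\beta_k}(\mu_{k-1})$ and $\langle\mu_{k-1},\beta_k^\vee\rangle<0$ for $1\le k\le r$; let $\mathrm{dist}(\mu,\nu)$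 be the maximal such $r$. For $\mu>\nu$ and a rational $0<\sigma<1$, a $\sigma$-chain for $(\mu,\nu)$ is a sequence $\mu=\mu_0>\mu_1>\dots>\mu_r=\nu$ in $W\lambda$ such that, for every $k$, $\mathrm{dist}(\mu_{k-1},\mu_k)=1$ and $\sigma\langle\mu_{k-1},\beta_k^\vee\rangle\in\mathbb Z_{<0}$, where $\beta_k$ is the positive real root with $\mu_k=r_{\beta_k}(\mu_{k-1})$. A Lakshmibai–Seshadri (LS) path of shape $\lambda$ is a pair $(\nu_1,\dots,\nu_s;\sigma_0,\dots,\sigma_s)$, $s\ge1$, with $\nu_1>\dots>\nu_s$ in $W\lambda$ and rational numbers $0=\sigma_0<\sigma_1<\dots<\sigma_s=1$, such that for each $1\le k\le s-1$ there is a $\sigma_k$-chain for $(\nu_k,\nu_{k+1})$. It is identified with the piecewise linear map $\pi:[0,1]\to\mathbb R\otimes_{\mathbb Z}P$ given by $\pi(t)=\sum_{k=1}^{j-1}(\sigma_k-\sigma_{k-1})\nu_k+(t-\sigma_{j-1})\nu_j$ for $\sigma_{j-1}\le t\le\sigma_j$. Let $\mathbb B(\lambda)$ be the set of all LS paths of shape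 $\lambda$. For $\pi\in\mathbb B(\lambda)$ and $i\in\{1,2\}$ let $H(t)=\langle\pi(t),\alpha_i^\vee\rangle$ and $m=\min_{[0,1]}H$. If $H(1)-m<1$ (equivalently, $H(1)=m$), put $f_i\pi=\mathbf 0$. Otherwise let $t_0=\max\{t: H(t)=m\}$, $t_1=\min\{t\ge t_0: H(t)=m+1\}$, and let $f_i\pi$ be the path equal to $\pi(t)$ for $t\le t_0$, to $r_i(\pi(t)-\pi(t_0))+\pi(t_0)$ for $t_0\le t\le t_1$, and to $\pi(t)-\alpha_i$ for $t\ge t_1$. The crystal graph of $\mathbb B(\lambda)$ has vertex set $\mathbb B(\lambda)$ and an edge from $\pi$ to $f_i\pi$ whenever $f_i\pi\ne\mathbf 0$. Theorem. The crystal graph of $\mathbb B(\Lambda_1-\Lambda_2)$ is connected (as an undirected graph). -/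

import Mathlib

/-! Lakshmibai-Seshadri paths for the rank 2 Kac-Moody algebra with Cartan matrix
`(2, -a; -b, 2)`.  The simple roots and coroots are indexed by `Fin 2` (so the indices
`1, 2` of the literature are `0, 1` here).  Since the Cartan matrix is invertible for
`ab ≠ 4`, the dual of the Cartan subalgebra has the fundamental weights as a basis, and
everything is written in that basis. -/

namespace RankTwo

/-- The weight lattice `P = ℤΛ₁ ⊕ ℤΛ₂`, in coordinates with respect to `Λ₁, Λ₂`; the
`i`-th coordinate of `μ` is the pairing `⟨μ, αᵢ^∨⟩`. -/
abbrev Weight : Type := Fin 2 → ℤ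

/-- The real form `ℝ ⊗ P` of the weight lattice, in the same coordinates. -/
abbrev RealWeight : Type := Fin 2 → ℝ

/-- The inclusion of `P` in `ℝ ⊗ P`. -/
def toReal (μ : Weight) : RealWeight := fun i => (μ i : ℝ)

/-- The generalized Cartan matrix `A`, with entries `A i j = ⟨αⱼ, αᵢ^∨⟩`. -/
def cartanMatrix (a b : ℤ) : Matrix (Fin 2) (Fin 2) ℤ := !![2, -a; -b, 2]

/-- The fundamental weight `Λᵢ`. -/
def fundamentalWeight (i : Fin 2) : Weight := Pi.single i 1

/-- The simple root `αᵢ`, that is `α₁ = 2Λ₁ - bΛ₂` and `α₂ = -aΛ₁ + 2Λ₂`. -/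
def simpleRoot (a b : ℤ) (i : Fin 2) : Weight := fun j => cartanMatrix a b j i

/-- The simple coroot `αᵢ^∨`, as a linear form on `P`. -/
def simpleCoroot (i : Fin 2) : Weight →ₗ[ℤ] ℤ := LinearMap.proj i

theorem simpleCoroot_simpleRoot (a b : ℤ) (i : Fin 2) :
    simpleCoroot i (simpleRoot a b i) = 2 := by
  fin_cases i <;> simp [simpleCoroot, simpleRoot, cartanMatrix]

/-- The simple reflection `rᵢ(μ) = μ - ⟨μ, αᵢ^∨⟩ αᵢ`. -/
def simpleReflection (a b : ℤ) (i : Fin 2) : Weight ≃ₗ[ℤ] Weight :=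
  Module.reflection (simpleCoroot_simpleRoot a b i)

/-- The Weyl group `W = ⟨r₁, r₂⟩`. -/
def weylGroup (a b : ℤ) : Subgroup (Weight ≃ₗ[ℤ] Weight) :=
  Subgroup.closure (Set.range (simpleReflection a b))

/-- `β` is a positive real root with dual root `βv`: for some `w ∈ W` and some `i`, we have
`β = w αᵢ` and `β^∨ = w αᵢ^∨`, i.e. `⟨μ, β^∨⟩ = ⟨w⁻¹ μ, αᵢ^∨⟩` for all `μ`; and `β` is a
combination of the simple roots with coefficients in the natural numbers. -/
def IsPosRealRoot (a b : ℤ) (β : Weight) (βv : Weight →ₗ[ℤ] ℤ) : Prop :=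
  (∃ w ∈ weylGroup a b, ∃ i : Fin 2,
    β = w (simpleRoot a b i) ∧ ∀ μ : Weight, βv μ = simpleCoroot i (w⁻¹ μ)) ∧
  ∃ c : Fin 2 → ℕ, β = ∑ i, c i • simpleRoot a b i

/-- `m 0, m 1, …, m r` is a chain for `(μ, ν)` in the orbit `Wλ`.  Here
`Module.preReflection β βv μ = μ - ⟨μ, β^∨⟩ β` is the reflection `r_β(μ)`. -/
def IsChain (a b : ℤ) (lam μ ν : Weight) (r : ℕ) (m : ℕ → Weight) : Prop :=
  m 0 = μ ∧ m r = ν ∧ (∀ k ≤ r, m k ∈ MulAction.orbit (weylGroup a b) lam) ∧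
  ∀ k < r, ∃ β βv, IsPosRealRoot a b β βv ∧
    m (k + 1) = Module.preReflection β βv (m k) ∧ βv (m k) < 0

/-- The order `μ ≥ ν` on the orbit `Wλ`. -/
def OrbitGE (a b : ℤ) (lam μ ν : Weight) : Prop := ∃ r m, IsChain a b lam μ ν r m

/-- The strict order `μ > ν` on the orbit `Wλ`. -/
def OrbitGT (a b : ℤ) (lam μ ν : Weight) : Prop := OrbitGE a b lam μ ν ∧ μ ≠ ν

/-- `dist(μ, ν) = d`: the maximal length of a chain for `(μ, ν)` is `d`. -/
def HasDist (a b : ℤ) (lam μ ν : Weight) (d : ℕ) : Prop :=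
  IsGreatest {r : ℕ | ∃ m, IsChain a b lam μ ν r m} d

/-- There is a `σ`-chain for `(μ, ν)`: a sequence `μ = μ₀ > μ₁ > ⋯ > μᵣ = ν` in `Wλ` with
`dist(μₖ₋₁, μₖ) = 1` and `σ⟨μₖ₋₁, βₖ^∨⟩` a negative integer, where `μₖ = r_{βₖ}(μₖ₋₁)`. -/
def ExistsSigmaChain (a b : ℤ) (lam : Weight) (σ : ℚ) (μ ν : Weight) : Prop :=
  ∃ (r : ℕ) (m : ℕ → Weight), m 0 = μ ∧ m r = ν ∧
    ∀ k < r, OrbitGT a b lam (m k) (m (k + 1)) ∧ HasDist a b lam (m k) (m (k + 1)) 1 ∧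
      ∃ β βv, IsPosRealRoot a b β βv ∧ m (k + 1) = Module.preReflection β βv (m k) ∧
        ∃ n : ℤ, n < 0 ∧ σ * (βv (m k) : ℚ) = n

/-- `(ν 0, …, ν (s - 1); σ 0, …, σ s)` is a Lakshmibai-Seshadri path of shape `λ`.
Only the values of `ν` below `s` and of `σ` up to `s` are relevant. -/
structure IsLSPair (a b : ℤ) (lam : Weight) (s : ℕ) (ν : ℕ → Weight) (σ : ℕ → ℚ) : Prop where
  one_le : 1 ≤ s
  mem_orbit : ∀ k < s, ν k ∈ MulAction.orbit (weylGroup a b) lam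
  decreasing : ∀ k, k + 1 < s → OrbitGT a b lam (ν k) (ν (k + 1))
  sigma_zero : σ 0 = 0
  sigma_last : σ s = 1
  sigma_lt : ∀ k < s, σ k < σ (k + 1)
  chain : ∀ k, k + 1 < s → ExistsSigmaChain a b lam (σ (k + 1)) (ν k) (ν (k + 1))

/-- A map `[0, 1] → ℝ ⊗ P`. -/
abbrev Path : Type := unitInterval → RealWeight

/-- `π` is the piecewise linear map attached to `(ν 0, …, ν (s - 1); σ 0, …, σ s)`. -/
def IsPathOf (π : Path) (s : ℕ) (ν : ℕ → Weight) (σ : ℕ → ℚ) : Prop :=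
  ∀ j < s, ∀ t : unitInterval, (σ j : ℝ) ≤ t → (t : ℝ) ≤ σ (j + 1) →
    π t = ∑ k ∈ Finset.range j, ((σ (k + 1) : ℝ) - σ k) • toReal (ν k)
      + ((t : ℝ) - σ j) • toReal (ν j)

/-- The set `𝔹(λ)` of all Lakshmibai-Seshadri paths of shape `λ`, viewed as maps. -/
def LSPaths (a b : ℤ) (lam : Weight) : Set Path :=
  {π | ∃ s ν σ, IsLSPair a b lam s ν σ ∧ IsPathOf π s ν σ}

/-- The function `Hᵢ^π(t) = ⟨π(t), αᵢ^∨⟩`. -/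
def height (i : Fin 2) (π : Path) (t : unitInterval) : ℝ := π t i

/-- The minimum `mᵢ^π` of `Hᵢ^π` on `[0, 1]`. -/
noncomputable def minHeight (i : Fin 2) (π : Path) : ℝ := sInf (Set.range (height i π))

/-- The last time at which `Hᵢ^π` takes its minimum. -/
noncomputable def fStart (i : Fin 2) (π : Path) : unitInterval :=
  sSup {t | height i π t = minHeight i π}

/-- The first time after `fStart` at which `Hᵢ^π` takes the value `mᵢ^π + 1`. -/
noncomputable def fEnd (i : Fin 2) (π : Path) : unitInterval :=
  sInf {t | fStart i π ≤ t ∧ height i π t = minHeight i π + 1}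

/-- The reflection `rᵢ` on `ℝ ⊗ P`. -/
def realReflection (a b : ℤ) (i : Fin 2) (v : RealWeight) : RealWeight :=
  v - v i • toReal (simpleRoot a b i)

open Classical in
/-- The root operator `fᵢ`; the value `none` stands for the extra element `𝟎`. -/
noncomputable def rootF (a b : ℤ) (i : Fin 2) (π : Path) : Option Path :=
  if 1 ≤ height i π 1 - minHeight i π then
    some fun t =>
      if t ≤ fStart i π then π t
      else if t ≤ fEnd i π then
        realReflection a b i (π t - π (fStart i π)) + π (fStart i π)
      else π t - toReal (simpleRoot a b i)
  else none

/-- The (undirected) crystal graph of `𝔹(λ)`: its vertices are the elements of `𝔹(λ)`, and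
there is an edge between `π` and `fᵢ π` for each `i` and each `π` with `fᵢ π ≠ 𝟎`. -/
def crystalGraph (a b : ℤ) (lam : Weight) : SimpleGraph (LSPaths a b lam) :=
  SimpleGraph.fromRel fun π π' => ∃ i : Fin 2, rootF a b i π.1 = some π'.1

end RankTwo

/-!
The weights in the orbit of `λ = Λ₁ - Λ₂` are enumerated as `x j`, obtained from `x 0 = λ` by
alternating simple reflections, and `x (j - 1) = x j + p j • α` with a simple root `α` and an
integer sequence `p` satisfying `p 0 = p 1 = 1` and `p (j + 1) + p (j - 1) = a p j` or `b p j`.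
All integers `j` are needed if `a, b ≥ 2`; if `a = 1` or `b = 1` then `λ` is conjugate to a
dominant or antidominant weight and a half-line of indices suffices.  On these indices the order
on the orbit is the reverse of the order on `ℤ`, so weights at distance one are adjacent
(`eq_sub_one_of_hasDist`).  Consecutive terms of `p` are coprime, so a `σ`-chain has a single step
(`ExistsSigmaChain.orbitWeight`).

Hence a Lakshmibai-Seshadri path runs through consecutive directions `x m, x (m - 1), …, x n` and
changes from `x j` to `x (j - 1)` at a time `c j / p j` with an integer `c j`.  The integer
sequences `c` with `0 ≤ c j ≤ p j` and `c (j + 1) / p (j + 1) ≤ c j / p j` for `n < j ≤ m` encode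
exactly the paths with directions among `x m, …, x n`; the values `0` and `p j` belong to breaks at
the ends of `[0, 1]` (`exists_windowPath_eq`, `IsBreakSeq.windowPath_mem`).  As `p 1 = 1`, there
is no break between `x 1` and `x 0`, so the directions may be taken with `n = 0` or with `m = 0`.

The local minima of a height function are at breaks and are integers, and `f` raises by one the
`c k` for which the break is the last minimum of the height (`IsBreakSeq.rootF_windowPath`).
If `n = 0` and the path is not the straight one, its first direction is one in which some height
decreases.  Therefore the path is of the form `f π'` with the sum of the `c j` smaller
for `π'` (`IsBreakSeq.exists_rootF_sub_single_eq`), and a descent leads to `c = 0`, the straight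
path in the direction `x 0`.  If `m = 0`, the last direction increases some height, so `f` applies
and raises the sum of the `c j` (`IsBreakSeq.exists_rootF_eq_add_single`), until `c = p`, which is
again the straight path.
-/

namespace RankTwo

/-! ### The orbit of `Λ₁ - Λ₂` -/

/-- The numbers `p 0, p 1, p 2, …` with `p 0 = p 1 = 1` and
`p (n + 2) = b p (n + 1) - p n` or `a p (n + 1) - p n` for `n` even or odd. -/
def orbitCoeffNat (a b : ℤ) : ℕ → ℤ
  | 0 => 1
  | 1 => 1
  | n + 2 => (if Even n then b else a) * orbitCoeffNat a b (n + 1) - orbitCoeffNat a b n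

/-- The two-sided sequence `p` with `p 0 = p 1 = 1` and `p (j + 1) + p (j - 1) = a p j` or `b p j`
for `j` even or odd.  Reversing the sequence about `1 / 2` exchanges `a` and `b`. -/
def orbitCoeff (a b : ℤ) : ℤ → ℤ
  | .ofNat n => orbitCoeffNat a b n
  | .negSucc n => orbitCoeffNat b a (n + 2)

theorem orbitCoeff_natCast (a b : ℤ) (n : ℕ) : orbitCoeff a b n = orbitCoeffNat a b n := rfl

theorem orbitCoeff_one_sub_natCast (a b : ℤ) (n : ℕ) :
    orbitCoeff a b (1 - n) = orbitCoeffNat b a n := by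
  match n with
  | 0 => rfl
  | 1 => rfl
  | n + 2 =>
    have : (1 - ((n + 2 : ℕ) : ℤ)) = Int.negSucc n := by omega
    rw [this]; rfl

@[simp] theorem orbitCoeff_zero (a b : ℤ) : orbitCoeff a b 0 = 1 := rfl

@[simp] theorem orbitCoeff_one (a b : ℤ) : orbitCoeff a b 1 = 1 := rfl

theorem orbitCoeffNat_add_two (a b : ℤ) (n : ℕ) : orbitCoeffNat a b (n + 2) =
    (if Even n then b else a) * orbitCoeffNat a b (n + 1) - orbitCoeffNat a b n := rfl

theorem orbitCoeff_add_one (a b j : ℤ) :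
    orbitCoeff a b (j + 1) = (if Even j then a else b) * orbitCoeff a b j
      - orbitCoeff a b (j - 1) := by
  rcases lt_or_ge 0 j with h | h
  · obtain ⟨n, rfl⟩ : ∃ n : ℕ, j = (n : ℤ) + 1 := ⟨(j - 1).toNat, by omega⟩
    have e1 : (n : ℤ) + 1 + 1 = ((n + 2 : ℕ) : ℤ) := by push_cast; ring
    have e2 : (n : ℤ) + 1 = ((n + 1 : ℕ) : ℤ) := by push_cast; ring
    have e3 : (n : ℤ) + 1 - 1 = ((n : ℕ) : ℤ) := by ring
    rw [e1, e3, e2, orbitCoeff_natCast, orbitCoeff_natCast, orbitCoeff_natCast,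
      orbitCoeffNat_add_two]
    by_cases hn : Even n <;> simp [hn]
  · obtain ⟨n, rfl⟩ : ∃ n : ℕ, j = -(n : ℤ) := ⟨(-j).toNat, by omega⟩
    have e1 : -(n : ℤ) + 1 = 1 - (n : ℕ) := by ring
    have e2 : -(n : ℤ) = 1 - ((n + 1 : ℕ) : ℤ) := by push_cast; ring
    have e3 : -(n : ℤ) - 1 = 1 - ((n + 2 : ℕ) : ℤ) := by push_cast; ring
    have e4 : Even (-(n : ℤ)) ↔ Even n := by rw [even_neg, Int.even_coe_nat]
    simp only [e4]
    rw [e3, e1, e2, orbitCoeff_one_sub_natCast, orbitCoeff_one_sub_natCast,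
      orbitCoeff_one_sub_natCast, orbitCoeffNat_add_two]
    ring

/-- The second inequality makes the induction work; it persists because `a * b ≥ 4`. -/
theorem orbitCoeffNat_pos_aux {a b : ℤ} (ha : 0 < a) (hb : 2 ≤ b) (hab : 4 < a * b) (n : ℕ) :
    0 < orbitCoeffNat a b (n + 1) ∧ 2 * orbitCoeffNat a b (n + 1) ≤
      (if Even n then a else b) * orbitCoeffNat a b (n + 2) := by
  induction n with
  | zero =>
    simp only [orbitCoeffNat, Even.zero, if_true]
    constructor <;> nlinarith
  | succ n ih =>
    obtain ⟨h0, h1⟩ := ih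
    rw [orbitCoeffNat_add_two a b (n + 1)]
    simp only [Nat.even_add_one] at h1 ⊢
    by_cases hn : Even n
    · simp only [hn, if_true, not_true_eq_false, if_false] at h1 ⊢
      have h2 : 0 < orbitCoeffNat a b (n + 2) := by nlinarith
      refine ⟨h2, ?_⟩
      nlinarith
    · simp only [hn, if_false, not_false_eq_true, if_true] at h1 ⊢
      have h2 : 0 < orbitCoeffNat a b (n + 2) := by nlinarith
      refine ⟨h2, ?_⟩
      nlinarith

theorem orbitCoeffNat_pos {a b : ℤ} (ha : 0 < a) (hb : 2 ≤ b) (hab : 4 < a * b) (n : ℕ) :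
    0 < orbitCoeffNat a b n := by
  cases n with
  | zero => exact one_pos
  | succ n => exact (orbitCoeffNat_pos_aux ha hb hab n).1

/-- The range of indices over which the orbit is enumerated without repetition: all integers
if `a, b ≥ 2`, the integers `j ≥ -1` if `a = 1`, and the integers `j ≤ 1` if `b = 1`. -/
def IsOrbitIndex (a b j : ℤ) : Prop := (j < -1 → 2 ≤ a) ∧ (1 < j → 2 ≤ b)

theorem IsOrbitIndex.of_mem {a b k l j : ℤ} (hk : IsOrbitIndex a b k) (hl : IsOrbitIndex a b l)
    (h1 : k ≤ j) (h2 : j ≤ l) : IsOrbitIndex a b j :=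
  ⟨fun h => hk.1 (by omega), fun h => hl.2 (by omega)⟩

theorem isOrbitIndex_zero (a b : ℤ) : IsOrbitIndex a b 0 := ⟨by omega, by omega⟩

theorem orbitCoeff_pos {a b j : ℤ} (ha : 0 < a) (hb : 0 < b) (hab : 4 < a * b)
    (h1 : IsOrbitIndex a b (j - 1)) (h2 : IsOrbitIndex a b j) : 0 < orbitCoeff a b j := by
  rcases lt_trichotomy j 0 with h | rfl | h
  · have ha2 : 2 ≤ a := h1.1 (by omega)
    obtain ⟨n, rfl⟩ : ∃ n : ℕ, j = 1 - (n : ℤ) := ⟨(1 - j).toNat, by omega⟩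
    rw [orbitCoeff_one_sub_natCast]
    exact orbitCoeffNat_pos hb ha2 (by linarith) n
  · simp
  · rcases eq_or_ne j 1 with rfl | h'
    · simp
    have hb2 : 2 ≤ b := h2.2 (by omega)
    obtain ⟨n, rfl⟩ : ∃ n : ℕ, j = (n : ℤ) := ⟨j.toNat, by omega⟩
    rw [orbitCoeff_natCast]
    exact orbitCoeffNat_pos ha hb2 hab n

theorem orbitCoeff_neg_one (a b : ℤ) : orbitCoeff a b (-1) = a - 1 := by
  have := orbitCoeff_add_one a b 0
  simp at this
  linarith

theorem orbitCoeff_two (a b : ℤ) : orbitCoeff a b 2 = b - 1 := by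
  have := orbitCoeff_add_one a b 1
  norm_num at this
  linarith

theorem orbitCoeff_nonneg {a b j : ℤ} (ha : 0 < a) (hb : 0 < b) (hab : 4 < a * b)
    (h : IsOrbitIndex a b j) : 0 ≤ orbitCoeff a b j := by
  by_cases h1 : IsOrbitIndex a b (j - 1)
  · exact (orbitCoeff_pos ha hb hab h1 h).le
  · have : j = -1 := by
      by_contra hj
      exact h1 ⟨fun h' => h.1 (by omega), fun h' => h.2 (by omega)⟩
    rw [this, orbitCoeff_neg_one]; omega

theorem orbitCoeff_add_one_nonneg {a b j : ℤ} (ha : 0 < a) (hb : 0 < b) (hab : 4 < a * b)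
    (h : IsOrbitIndex a b j) : 0 ≤ orbitCoeff a b (j + 1) := by
  by_cases h1 : IsOrbitIndex a b (j + 1)
  · exact orbitCoeff_nonneg ha hb hab h1
  · have : j = 1 := by
      by_contra hj
      exact h1 ⟨fun h' => h.1 (by omega), fun h' => h.2 (by omega)⟩
    rw [this, one_add_one_eq_two, orbitCoeff_two]; omega

theorem isCoprime_orbitCoeff (a b j : ℤ) :
    IsCoprime (orbitCoeff a b j) (orbitCoeff a b (j + 1)) := by
  induction j using Int.induction_on with
  | zero => simpa using isCoprime_one_left
  | succ n ih =>
    rw [orbitCoeff_add_one a b (n + 1), add_sub_cancel_right, sub_eq_neg_add]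
    exact ih.symm.neg_right.add_mul_right_right _
  | pred n ih =>
    rw [sub_add_cancel]
    have h := orbitCoeff_add_one a b (-n)
    have : orbitCoeff a b (-n - 1) = -orbitCoeff a b (-n + 1)
        + (if Even (-n : ℤ) then a else b) * orbitCoeff a b (-n) := by rw [h]; ring
    rw [this]
    exact (ih.neg_right.add_mul_right_right _).symm

/-- The `j`-th element `x j` of the orbit: starting from `x 0 = Λ₁ - Λ₂`, the simple reflections
are applied alternately, beginning with `r₁` for `j > 0` and with `r₂` for `j < 0`. -/
def orbitWeight (a b j : ℤ) : Weight :=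
  if Even j then ![orbitCoeff a b (j + 1), -orbitCoeff a b j]
  else ![-orbitCoeff a b j, orbitCoeff a b (j + 1)]

/-- The index `i` of the simple reflection taking `x j` to `x (j - 1)`. -/
def descent (j : ℤ) : Fin 2 := if Even j then 1 else 0

theorem descent_eq_or (i : Fin 2) (j : ℤ) : i = descent j ∨ i = descent (j + 1) := by
  by_cases h : Even j <;> fin_cases i <;> simp [descent, h]

theorem descent_add_two (j : ℤ) : descent (j + 2) = descent j := by
  simp [descent]

theorem orbitWeight_apply_descent (a b j : ℤ) :
    orbitWeight a b j (descent j) = -orbitCoeff a b j := by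
  by_cases h : Even j <;> simp [descent, orbitWeight, h]

theorem orbitWeight_apply_descent_add_one (a b j : ℤ) :
    orbitWeight a b j (descent (j + 1)) = orbitCoeff a b (j + 1) := by
  by_cases h : Even j <;> simp [descent, orbitWeight, h, ← Int.not_even_iff_odd]

theorem simpleRoot_apply_self (a b : ℤ) (i : Fin 2) : simpleRoot a b i i = 2 :=
  simpleCoroot_simpleRoot a b i

theorem orbitWeight_sub_one (a b j : ℤ) : orbitWeight a b (j - 1) =
    orbitWeight a b j + orbitCoeff a b j • simpleRoot a b (descent j) := by
  have h1 := orbitCoeff_add_one a b j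
  by_cases h : Even j
  · have h2 : ¬ Even (j - 1) := by simp [h]
    ext i
    fin_cases i <;> simp [orbitWeight, descent, simpleRoot, cartanMatrix, h, h2] <;>
      simp [h] at h1 <;> linarith
  · have h2 : Even (j - 1) := Int.even_sub_one.mpr h
    ext i
    fin_cases i <;> simp [orbitWeight, descent, simpleRoot, cartanMatrix, h, h2] <;>
      simp [h] at h1 <;> linarith

theorem simpleReflection_apply (a b : ℤ) (i : Fin 2) (μ : Weight) :
    simpleReflection a b i μ = μ - μ i • simpleRoot a b i := by
  simp [simpleReflection, Module.reflection_apply, simpleCoroot]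

theorem simpleReflection_orbitWeight (a b j : ℤ) :
    simpleReflection a b (descent j) (orbitWeight a b j) = orbitWeight a b (j - 1) := by
  rw [simpleReflection_apply, orbitWeight_apply_descent, orbitWeight_sub_one]
  simp

theorem simpleReflection_involutive (a b : ℤ) (i : Fin 2) (μ : Weight) :
    simpleReflection a b i (simpleReflection a b i μ) = μ :=
  Module.involutive_reflection (simpleCoroot_simpleRoot a b i) μ

theorem simpleReflection_orbitWeight_add_one (a b j : ℤ) :
    simpleReflection a b (descent (j + 1)) (orbitWeight a b j) = orbitWeight a b (j + 1) := by
  have h := simpleReflection_orbitWeight a b (j + 1)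
  rw [add_sub_cancel_right] at h
  rw [← h, simpleReflection_involutive]

theorem simpleReflection_mem (a b : ℤ) (i : Fin 2) : simpleReflection a b i ∈ weylGroup a b :=
  Subgroup.subset_closure ⟨i, rfl⟩

theorem orbitWeight_zero (a b : ℤ) :
    orbitWeight a b 0 = fundamentalWeight 0 - fundamentalWeight 1 := by
  ext i
  fin_cases i <;> simp [orbitWeight, fundamentalWeight]

/-- The orbit of `Λ₁ - Λ₂` under the Weyl group. -/
abbrev extremalOrbit (a b : ℤ) : Set Weight :=
  MulAction.orbit (weylGroup a b) (fundamentalWeight 0 - fundamentalWeight 1 : Weight)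

theorem simpleReflection_mem_orbit {a b : ℤ} {μ : Weight} (i : Fin 2)
    (h : μ ∈ extremalOrbit a b) : simpleReflection a b i μ ∈ extremalOrbit a b :=
  (MulAction.mem_orbit_of_mem_orbit
    (⟨simpleReflection a b i, simpleReflection_mem a b i⟩ : weylGroup a b) h :)

theorem orbitWeight_mem_orbit (a b j : ℤ) : orbitWeight a b j ∈ extremalOrbit a b := by
  induction j using Int.induction_on with
  | zero => rw [orbitWeight_zero]; exact MulAction.mem_orbit_self _
  | succ n ih =>
    rw [← simpleReflection_orbitWeight_add_one]; exact simpleReflection_mem_orbit _ ih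
  | pred n ih => rw [← simpleReflection_orbitWeight]; exact simpleReflection_mem_orbit _ ih

/-- At an end of the index range the reflection leading out of it fixes the weight, since
`p (-1) = 0` if `a = 1` and `p 2 = 0` if `b = 1`. -/
theorem exists_simpleReflection_orbitWeight {a b j : ℤ} (ha : 0 < a) (hb : 0 < b)
    (hj : IsOrbitIndex a b j) (i : Fin 2) : ∃ k, IsOrbitIndex a b k ∧
      simpleReflection a b i (orbitWeight a b j) = orbitWeight a b k := by
  rcases descent_eq_or i j with rfl | rfl
  · by_cases h1 : IsOrbitIndex a b (j - 1)
    · exact ⟨j - 1, h1, simpleReflection_orbitWeight a b j⟩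
    · have hj1 : j = -1 := by
        by_contra hj'
        exact h1 ⟨fun h' => hj.1 (by omega), fun h' => hj.2 (by omega)⟩
      have ha1 : a = 1 := by
        by_contra ha'
        exact h1 ⟨fun h' => by omega, fun h' => by omega⟩
      refine ⟨j, hj, ?_⟩
      rw [simpleReflection_apply, orbitWeight_apply_descent, hj1, orbitCoeff_neg_one, ha1]
      simp
  · by_cases h1 : IsOrbitIndex a b (j + 1)
    · exact ⟨j + 1, h1, simpleReflection_orbitWeight_add_one a b j⟩
    · have hj1 : j = 1 := by
        by_contra hj'
        exact h1 ⟨fun h' => hj.1 (by omega), fun h' => hj.2 (by omega)⟩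
      have hb1 : b = 1 := by
        by_contra hb'
        exact h1 ⟨fun h' => by omega, fun h' => by omega⟩
      refine ⟨j, hj, ?_⟩
      rw [simpleReflection_apply, orbitWeight_apply_descent_add_one, hj1, one_add_one_eq_two,
        orbitCoeff_two, hb1]
      simp

theorem simpleReflection_inv (a b : ℤ) (i : Fin 2) :
    (simpleReflection a b i)⁻¹ = simpleReflection a b i :=
  inv_eq_of_mul_eq_one_left (LinearEquiv.ext (simpleReflection_involutive a b i))

/-- A property of weights preserved by the simple reflections is preserved by the Weyl group. -/
theorem weylGroup_induction {a b : ℤ} {Q : Weight → Prop}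
    (hQ : ∀ i μ, Q μ → Q (simpleReflection a b i μ)) {w : Weight ≃ₗ[ℤ] Weight}
    (hw : w ∈ weylGroup a b) {μ : Weight} (hμ : Q μ) : Q (w μ) := by
  induction hw using Subgroup.closure_induction_left with
  | one => exact hμ
  | mul_left x hx y hy ih =>
    obtain ⟨i, rfl⟩ := hx
    exact hQ i _ ih
  | inv_mul_cancel x hx y hy ih =>
    obtain ⟨i, rfl⟩ := hx
    rw [simpleReflection_inv]
    exact hQ i _ ih

theorem exists_eq_orbitWeight {a b : ℤ} (ha : 0 < a) (hb : 0 < b) {μ : Weight}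
    (h : μ ∈ extremalOrbit a b) : ∃ j, IsOrbitIndex a b j ∧ μ = orbitWeight a b j := by
  obtain ⟨⟨w, hw⟩, rfl⟩ := h
  refine weylGroup_induction (Q := fun μ => ∃ j, IsOrbitIndex a b j ∧ μ = orbitWeight a b j)
    ?_ hw ⟨0, isOrbitIndex_zero a b, (orbitWeight_zero a b).symm⟩
  rintro i _ ⟨j, hj, rfl⟩
  exact exists_simpleReflection_orbitWeight ha hb hj i

/-! ### The order on the orbit -/

/-- A multiple of the height of a weight: a linear form taking the same value `a b - 4` at both
simple roots. -/
def scaledHeight (a b : ℤ) (μ : Weight) : ℤ := -((2 + b) * μ 0 + (2 + a) * μ 1)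

theorem scaledHeight_add_smul (a b z : ℤ) (μ ν : Weight) :
    scaledHeight a b (μ + z • ν) = scaledHeight a b μ + z * scaledHeight a b ν := by
  simp only [scaledHeight, Pi.add_apply, Pi.smul_apply, smul_eq_mul]; ring

theorem scaledHeight_simpleRoot (a b : ℤ) (i : Fin 2) :
    scaledHeight a b (simpleRoot a b i) = a * b - 4 := by
  fin_cases i <;> simp [scaledHeight, simpleRoot, cartanMatrix] <;> ring

theorem scaledHeight_orbitWeight_lt {a b k l : ℤ} (ha : 0 < a) (hb : 0 < b) (hab : 4 < a * b)
    (hk : IsOrbitIndex a b k) (hl : IsOrbitIndex a b l) (hkl : k < l) :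
    scaledHeight a b (orbitWeight a b l) < scaledHeight a b (orbitWeight a b k) := by
  obtain ⟨n, rfl⟩ : ∃ n : ℕ, l = k + 1 + n := ⟨(l - k - 1).toNat, by omega⟩
  clear hkl
  have key : ∀ j, IsOrbitIndex a b (j - 1) → IsOrbitIndex a b j →
      scaledHeight a b (orbitWeight a b j) < scaledHeight a b (orbitWeight a b (j - 1)) := by
    intro j h1 h2
    rw [orbitWeight_sub_one, scaledHeight_add_smul, scaledHeight_simpleRoot]
    have := orbitCoeff_pos ha hb hab h1 h2
    nlinarith
  induction n with
  | zero => simpa using key (k + 1) (by simpa using hk) (by simpa using hl)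
  | succ n ih =>
    have h1 : IsOrbitIndex a b (k + 1 + n) := hk.of_mem hl (by omega) (by push_cast; omega)
    refine lt_trans ?_ (ih h1)
    have e : k + 1 + ((n + 1 : ℕ) : ℤ) - 1 = k + 1 + n := by push_cast; ring
    have := key (k + 1 + ((n + 1 : ℕ) : ℤ)) (by rwa [e]) hl
    rwa [e] at this

theorem orbitWeight_injOn {a b k l : ℤ} (ha : 0 < a) (hb : 0 < b) (hab : 4 < a * b)
    (hk : IsOrbitIndex a b k) (hl : IsOrbitIndex a b l)
    (h : orbitWeight a b k = orbitWeight a b l) : k = l := by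
  rcases lt_trichotomy k l with h' | h' | h'
  · exact absurd (h ▸ scaledHeight_orbitWeight_lt ha hb hab hk hl h') (lt_irrefl _)
  · exact h'
  · exact absurd (h ▸ scaledHeight_orbitWeight_lt ha hb hab hl hk h') (lt_irrefl _)

theorem simpleRoot_linearIndependent {a b e f e' f' : ℤ} (hab : 4 < a * b)
    (h : e • simpleRoot a b 0 + f • simpleRoot a b 1
      = e' • simpleRoot a b 0 + f' • simpleRoot a b 1) : e = e' ∧ f = f' := by
  have h0 := congrFun h 0
  have h1 := congrFun h 1
  simp [simpleRoot, cartanMatrix] at h0 h1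
  have h2 : (e - e') * (a * b - 4) = 0 := by linear_combination (-2) * h0 - a * h1
  have h3 : (f - f') * (a * b - 4) = 0 := by linear_combination (-b) * h0 - 2 * h1
  have h4 : a * b - 4 ≠ 0 := by omega
  constructor
  · have := (mul_eq_zero.mp h2).resolve_right h4; omega
  · have := (mul_eq_zero.mp h3).resolve_right h4; omega

theorem simpleRoot_ne_zero (a b : ℤ) (i : Fin 2) : simpleRoot a b i ≠ 0 := by
  intro h
  have := simpleRoot_apply_self a b i
  simp [h] at this

theorem IsPosRealRoot.scaledHeight_pos {a b : ℤ} (hab : 4 < a * b) {β : Weight}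
    {βv : Weight →ₗ[ℤ] ℤ} (h : IsPosRealRoot a b β βv) : 0 < scaledHeight a b β := by
  obtain ⟨⟨w, hw, i, hβ, -⟩, c, hc⟩ := h
  have h1 : β = 0 + (c 0 : ℤ) • simpleRoot a b 0 + (c 1 : ℤ) • simpleRoot a b 1 := by
    rw [hc, Fin.sum_univ_two, zero_add]; simp
  have hne : β ≠ 0 := by
    rw [hβ]
    exact (map_ne_zero_iff w w.injective).mpr (simpleRoot_ne_zero a b i)
  rw [h1, scaledHeight_add_smul, scaledHeight_add_smul, scaledHeight_simpleRoot,
    scaledHeight_simpleRoot]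
  have h2 : scaledHeight a b 0 = 0 := by simp [scaledHeight]
  have h3 : 0 < (c 0 : ℤ) + c 1 := by
    by_contra h4
    have h5 : c 0 = 0 := by omega
    have h6 : c 1 = 0 := by omega
    exact hne (by simp [h1, h5, h6])
  rw [h2]
  nlinarith

theorem isPosRealRoot_simpleRoot (a b : ℤ) (i : Fin 2) :
    IsPosRealRoot a b (simpleRoot a b i) (simpleCoroot i) := by
  refine ⟨⟨1, one_mem _, i, rfl, fun μ => by simp⟩, Pi.single i 1, ?_⟩
  fin_cases i <;> simp [Fin.sum_univ_two]

/-- Reflections that go down in the order lower the index. -/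
theorem lt_of_reflection {a b k l : ℤ} (ha : 0 < a) (hb : 0 < b) (hab : 4 < a * b)
    (hk : IsOrbitIndex a b k) (hl : IsOrbitIndex a b l) {β : Weight}
    {βv : Weight →ₗ[ℤ] ℤ} (h : IsPosRealRoot a b β βv)
    (h1 : orbitWeight a b l = Module.preReflection β βv (orbitWeight a b k))
    (h2 : βv (orbitWeight a b k) < 0) : l < k := by
  by_contra hkl
  have h3 : scaledHeight a b (orbitWeight a b k) < scaledHeight a b (orbitWeight a b l) := by
    rw [h1, Module.preReflection_apply, sub_eq_add_neg, ← neg_smul, scaledHeight_add_smul]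
    have := h.scaledHeight_pos hab
    nlinarith
  rcases (not_lt.mp hkl).eq_or_lt with rfl | h4
  · exact lt_irrefl _ h3
  · exact lt_asymm h3 (scaledHeight_orbitWeight_lt ha hb hab hk hl h4)

theorem exists_isChain_orbitWeight {a b k : ℤ} (ha : 0 < a) (hb : 0 < b) (hab : 4 < a * b)
    (hk : IsOrbitIndex a b k) (r : ℕ) (hl : IsOrbitIndex a b (k - r)) :
    IsChain a b (fundamentalWeight 0 - fundamentalWeight 1) (orbitWeight a b k)
      (orbitWeight a b (k - r)) r (fun t => orbitWeight a b (k - t)) := by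
  refine ⟨by simp, rfl, fun t _ => orbitWeight_mem_orbit a b _, fun t ht => ?_⟩
  refine ⟨_, _, isPosRealRoot_simpleRoot a b (descent (k - t)), ?_, ?_⟩
  · have := simpleReflection_orbitWeight a b (k - t)
    rw [simpleReflection_apply] at this
    rw [Module.preReflection_apply]
    have e : k - ((t + 1 : ℕ) : ℤ) = k - t - 1 := by push_cast; ring
    simp only [e]
    exact this.symm
  · have := orbitWeight_apply_descent a b (k - t)
    have h2 := orbitCoeff_pos ha hb hab (j := k - t) (hl.of_mem hk (by omega) (by omega))
      (hl.of_mem hk (by omega) (by omega))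
    simp only [simpleCoroot, LinearMap.proj_apply]
    omega

theorem le_of_isChain {a b k l : ℤ} (ha : 0 < a) (hb : 0 < b) (hab : 4 < a * b)
    (hk : IsOrbitIndex a b k) (hl : IsOrbitIndex a b l) {r : ℕ} {m : ℕ → Weight}
    (h : IsChain a b (fundamentalWeight 0 - fundamentalWeight 1) (orbitWeight a b k)
      (orbitWeight a b l) r m) : l ≤ k - r := by
  obtain ⟨h0, hr, hmem, hstep⟩ := h
  have key : ∀ t ≤ r, ∀ j, IsOrbitIndex a b j → m t = orbitWeight a b j → j ≤ k - t := by
    intro t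
    induction t with
    | zero =>
      intro _ j hj hm
      rw [orbitWeight_injOn ha hb hab hj hk (hm ▸ h0)]
      simp
    | succ t ih =>
      intro ht j hj hm
      obtain ⟨j', hj', hm'⟩ := exists_eq_orbitWeight ha hb (hmem t (by omega))
      have h1 := ih (by omega) j' hj' hm'
      obtain ⟨β, βv, hβ, h2, h3⟩ := hstep t (by omega)
      rw [hm, hm'] at h2
      have := lt_of_reflection ha hb hab hj' hj hβ h2 (hm' ▸ h3)
      push_cast
      omega
  exact key r le_rfl l hl hr

theorem hasDist_orbitWeight_sub_one {a b k : ℤ} (ha : 0 < a) (hb : 0 < b) (hab : 4 < a * b)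
    (hk : IsOrbitIndex a b k) (hl : IsOrbitIndex a b (k - 1)) :
    HasDist a b (fundamentalWeight 0 - fundamentalWeight 1) (orbitWeight a b k)
      (orbitWeight a b (k - 1)) 1 := by
  constructor
  · have := exists_isChain_orbitWeight ha hb hab hk 1 (by simpa using hl)
    rw [Nat.cast_one] at this
    exact ⟨_, this⟩
  · rintro r ⟨m, hm⟩
    have := le_of_isChain ha hb hab hk hl hm
    omega

theorem orbitGT_orbitWeight_sub_one {a b k : ℤ} (ha : 0 < a) (hb : 0 < b) (hab : 4 < a * b)
    (hk : IsOrbitIndex a b k) (hl : IsOrbitIndex a b (k - 1)) :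
    OrbitGT a b (fundamentalWeight 0 - fundamentalWeight 1) (orbitWeight a b k)
      (orbitWeight a b (k - 1)) := by
  refine ⟨⟨1, (hasDist_orbitWeight_sub_one ha hb hab hk hl).1⟩, fun h => ?_⟩
  have := orbitWeight_injOn ha hb hab hk hl h
  omega

theorem eq_sub_one_of_hasDist {a b k l : ℤ} (ha : 0 < a) (hb : 0 < b) (hab : 4 < a * b)
    (hk : IsOrbitIndex a b k) (hl : IsOrbitIndex a b l)
    (h : HasDist a b (fundamentalWeight 0 - fundamentalWeight 1) (orbitWeight a b k)
      (orbitWeight a b l) 1) : l = k - 1 := by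
  obtain ⟨⟨m, hm⟩, h2⟩ := h
  have h1 := le_of_isChain ha hb hab hk hl hm
  obtain ⟨r, rfl⟩ : ∃ r : ℕ, l = k - r := ⟨(k - l).toNat, by omega⟩
  have := h2 ⟨_, exists_isChain_orbitWeight ha hb hab hk r hl⟩
  omega

/-- The root lattice is stable under the Weyl group. -/
theorem weylGroup_simpleRoot {a b : ℤ} {w : Weight ≃ₗ[ℤ] Weight} (hw : w ∈ weylGroup a b)
    (i : Fin 2) :
    ∃ e f : ℤ, w (simpleRoot a b i) = e • simpleRoot a b 0 + f • simpleRoot a b 1 := by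
  refine weylGroup_induction
    (Q := fun μ => ∃ e f : ℤ, μ = e • simpleRoot a b 0 + f • simpleRoot a b 1) ?_ hw ?_
  · rintro i μ ⟨e, f, rfl⟩
    rw [simpleReflection_apply]
    generalize (e • simpleRoot a b 0 + f • simpleRoot a b 1) i = z
    fin_cases i
    · exact ⟨e - z, f, by simp only [Fin.zero_eta, sub_smul]; abel⟩
    · exact ⟨e, f - z, by simp only [Fin.mk_one, sub_smul]; abel⟩
  · fin_cases i
    · exact ⟨1, 0, by simp⟩
    · exact ⟨0, 1, by simp⟩

/-- A real root reflecting `x j` to `x (j - 1)` is the simple root: it is a multiple of the simple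
root, and real roots are primitive in the root lattice. -/
theorem coroot_orbitWeight {a b j : ℤ} (hab : 4 < a * b) (hj : 0 < orbitCoeff a b j)
    {β : Weight} {βv : Weight →ₗ[ℤ] ℤ} (h : IsPosRealRoot a b β βv)
    (h1 : orbitWeight a b (j - 1) = Module.preReflection β βv (orbitWeight a b j)) :
    βv (orbitWeight a b j) = -orbitCoeff a b j := by
  obtain ⟨⟨w, hw, i, hβ, -⟩, c, hc⟩ := h
  rw [Module.preReflection_apply, orbitWeight_sub_one, sub_eq_add_neg, add_right_inj,
    ← neg_smul] at h1
  suffices h2 : -βv (orbitWeight a b j) = orbitCoeff a b j by omega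
  generalize -βv (orbitWeight a b j) = N at h1 ⊢
  obtain ⟨e, f, hef⟩ := weylGroup_simpleRoot (inv_mem hw) (descent j)
  have hβ' : w⁻¹ β = simpleRoot a b i := by rw [hβ]; exact w.symm_apply_apply _
  have hc' : β = (c 0 : ℤ) • simpleRoot a b 0 + (c 1 : ℤ) • simpleRoot a b 1 := by
    rw [hc, Fin.sum_univ_two]; simp
  -- `β` is `q` times the simple root, and `w⁻¹ β` is a simple root, so `q` is a unit.
  have key : ∀ q : ℕ, β = (q : ℤ) • simpleRoot a b (descent j) → q = 1 := by
    intro q hq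
    rw [hq, map_zsmul, hef, smul_add, smul_smul, smul_smul] at hβ'
    have h3 : ∃ z : ℤ, (q : ℤ) * z = 1 := by
      rcases Fin.exists_fin_two.mp ⟨i, rfl⟩ with hi | hi
      · exact ⟨e, (simpleRoot_linearIndependent (e' := 1) (f' := 0) hab
          (by rw [hβ', hi, one_smul, zero_smul, add_zero])).1⟩
      · exact ⟨f, (simpleRoot_linearIndependent (e' := 0) (f' := 1) hab
          (by rw [hβ', hi, one_smul, zero_smul, zero_add])).2⟩
    obtain ⟨z, hz⟩ := h3
    have := Int.eq_one_or_neg_one_of_mul_eq_one hz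
    omega
  rw [hc', smul_add, smul_smul, smul_smul] at h1
  rcases Fin.exists_fin_two.mp ⟨descent j, rfl⟩ with hd | hd
  · rw [hd] at h1 key
    obtain ⟨h4, h5⟩ := simpleRoot_linearIndependent (e := orbitCoeff a b j) (f := 0) hab
      (Eq.trans (by rw [zero_smul, add_zero]) h1)
    have h6 : c 1 = 0 := by
      have : (c 1 : ℤ) = 0 :=
        (mul_eq_zero.mp h5.symm).resolve_left (by rintro rfl; simp at h4; omega)
      exact_mod_cast this
    rw [key (c 0) (by simp [hc', h6])] at h4
    simpa using h4.symm
  · rw [hd] at h1 key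
    obtain ⟨h5, h4⟩ := simpleRoot_linearIndependent (e := 0) (f := orbitCoeff a b j) hab
      (Eq.trans (by rw [zero_smul, zero_add]) h1)
    have h6 : c 0 = 0 := by
      have : (c 0 : ℤ) = 0 :=
        (mul_eq_zero.mp h5.symm).resolve_left (by rintro rfl; simp at h4; omega)
      exact_mod_cast this
    rw [key (c 1) (by simp [hc', h6])] at h4
    simpa using h4.symm

/-- As consecutive terms of `p` are coprime, a `σ`-chain has only one step. -/
theorem ExistsSigmaChain.orbitWeight {a b k l : ℤ} (ha : 0 < a) (hb : 0 < b) (hab : 4 < a * b)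
    (hk : IsOrbitIndex a b k) (hl : IsOrbitIndex a b l) {σ : ℚ} (h0 : 0 < σ) (h1 : σ < 1)
    (hne : orbitWeight a b k ≠ orbitWeight a b l)
    (h : ExistsSigmaChain a b (fundamentalWeight 0 - fundamentalWeight 1) σ
      (orbitWeight a b k) (orbitWeight a b l)) :
    l = k - 1 ∧ ∃ z : ℤ, σ * orbitCoeff a b k = z := by
  obtain ⟨r, m, hm0, hmr, hstep⟩ := h
  have step : ∀ t < r, ∀ j, IsOrbitIndex a b j → m t = RankTwo.orbitWeight a b j →
      IsOrbitIndex a b (j - 1) ∧ m (t + 1) = RankTwo.orbitWeight a b (j - 1) ∧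
        ∃ z : ℤ, σ * orbitCoeff a b j = z := by
    intro t ht j hj hmt
    obtain ⟨-, hdist, β, βv, hβ, h2, z, -, hz⟩ := hstep t ht
    obtain ⟨j', hj', hmt'⟩ : ∃ j', IsOrbitIndex a b j' ∧
        m (t + 1) = RankTwo.orbitWeight a b j' := by
      obtain ⟨⟨m', -, hm', hmem, -⟩, -⟩ := hdist
      exact exists_eq_orbitWeight ha hb (hm' ▸ hmem 1 le_rfl)
    rw [hmt, hmt'] at hdist
    obtain rfl := eq_sub_one_of_hasDist ha hb hab hj hj' hdist
    rw [hmt', hmt] at h2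
    rw [hmt, coroot_orbitWeight hab (orbitCoeff_pos ha hb hab hj' hj) hβ h2] at hz
    refine ⟨hj', hmt', -z, ?_⟩
    push_cast at hz ⊢
    linarith
  match r, hmr with
  | 0, hmr => exact absurd (hm0.symm.trans hmr) hne
  | 1, hmr =>
    obtain ⟨h3, h4, h5⟩ := step 0 one_pos k hk hm0
    exact ⟨orbitWeight_injOn ha hb hab hl h3 (hmr.symm.trans h4), h5⟩
  | r + 2, hmr =>
    obtain ⟨h3, h4, z, hz⟩ := step 0 (by omega) k hk hm0
    obtain ⟨-, -, y, hy⟩ := step 1 (by omega) (k - 1) h3 h4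
    obtain ⟨e, f, hef⟩ := isCoprime_orbitCoeff a b (k - 1)
    rw [sub_add_cancel] at hef
    have hef' : (e : ℚ) * orbitCoeff a b (k - 1) + f * orbitCoeff a b k = 1 := by
      exact_mod_cast hef
    have h6 : σ = ((e * y + f * z : ℤ) : ℚ) := by
      push_cast
      linear_combination (-σ) * hef' + e * hy + f * hz
    rw [h6] at h0 h1
    have h7 : 0 < e * y + f * z := by exact_mod_cast h0
    have h8 : e * y + f * z < 1 := by exact_mod_cast h1
    omega

theorem existsSigmaChain_orbitWeight {a b k : ℤ} (ha : 0 < a) (hb : 0 < b) (hab : 4 < a * b)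
    (hk : IsOrbitIndex a b k) (hl : IsOrbitIndex a b (k - 1)) {σ : ℚ} (h0 : 0 < σ) {z : ℤ}
    (hz : σ * orbitCoeff a b k = z) :
    ExistsSigmaChain a b (fundamentalWeight 0 - fundamentalWeight 1) σ
      (orbitWeight a b k) (orbitWeight a b (k - 1)) := by
  have hp := orbitCoeff_pos ha hb hab hl hk
  refine ⟨1, fun t => orbitWeight a b (k - t), by simp, by simp, fun t ht => ?_⟩
  obtain rfl : t = 0 := by omega
  simp only [Nat.cast_zero, sub_zero, zero_add, Nat.cast_one]
  refine ⟨orbitGT_orbitWeight_sub_one ha hb hab hk hl,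
    hasDist_orbitWeight_sub_one ha hb hab hk hl, _, _,
    isPosRealRoot_simpleRoot a b (descent k), ?_, -z, ?_, ?_⟩
  · rw [← simpleReflection_orbitWeight, simpleReflection_apply]; rfl
  · have : (0 : ℚ) < z := by rw [← hz]; positivity
    have : 0 < z := by exact_mod_cast this
    omega
  · have := orbitWeight_apply_descent a b k
    simp only [simpleCoroot, LinearMap.proj_apply, this]
    push_cast
    linarith

/-! ### The root operator on a path with a known minimum -/

/-- Evaluation of `fᵢ` when the last minimum of the height is at `t₀` and the height grows at
constant slope `q` on `[t₀, t₁]`, where `t₁ - t₀ = 1 / q`. -/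
theorem rootF_eq_some (a b : ℤ) (i : Fin 2) (π : Path) {t₀ t₁ : unitInterval} {q : ℝ}
    (hq : 0 < q) (hmin : ∀ t, height i π t₀ ≤ height i π t)
    (hlast : ∀ t, t₀ < t → height i π t₀ < height i π t)
    (hslope : ∀ t, t₀ ≤ t → t ≤ t₁ → height i π t = height i π t₀ + q * ((t : ℝ) - t₀))
    (hlen : q * ((t₁ : ℝ) - t₀) = 1) (hend : 1 ≤ height i π 1 - height i π t₀) :
    rootF a b i π = some fun t =>
      if t ≤ t₀ then π t
      else if t ≤ t₁ then π t - (q * ((t : ℝ) - t₀)) • toReal (simpleRoot a b i)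
      else π t - toReal (simpleRoot a b i) := by
  have h01 : t₀ ≤ t₁ := by
    by_contra h
    have h' : (t₁ : ℝ) < t₀ := not_le.mp h
    nlinarith
  have hm : minHeight i π = height i π t₀ :=
    IsLeast.csInf_eq ⟨⟨t₀, rfl⟩, by rintro _ ⟨t, rfl⟩; exact hmin t⟩
  have hs : fStart i π = t₀ := by
    refine IsGreatest.csSup_eq ⟨hm.symm, fun t ht => ?_⟩
    by_contra h
    have h2 := hlast t (not_le.mp h)
    rw [Set.mem_ofPred_eq, hm] at ht
    linarith
  have he : fEnd i π = t₁ := by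
    refine IsLeast.csInf_eq ⟨⟨hs ▸ h01, by rw [hm, hslope t₁ h01 le_rfl, hlen]⟩, fun t ht => ?_⟩
    obtain ⟨h1, h2⟩ := ht
    rw [hs] at h1
    rw [hm] at h2
    by_contra h
    have h' : (t : ℝ) < t₁ := not_le.mp h
    have h3 := hslope t h1 (not_le.mp h).le
    nlinarith
  rw [rootF, hm, hs, he, if_pos hend]
  congr 1
  funext t
  split_ifs with h1 h2
  · rfl
  · have h3 := hslope t (not_le.mp h1).le h2
    simp only [height] at h3
    rw [realReflection, Pi.sub_apply, h3]
    ring_nf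
  · rfl

theorem exists_last_min {f : ℝ → ℝ} (hf : Continuous f) : ∃ t ∈ Set.Icc (0 : ℝ) 1,
    (∀ s ∈ Set.Icc (0 : ℝ) 1, f t ≤ f s) ∧ ∀ s ∈ Set.Icc (0 : ℝ) 1, t < s → f t < f s := by
  obtain ⟨t, ht, hmin⟩ := isCompact_Icc.exists_isMinOn (s := Set.Icc (0 : ℝ) 1) ⟨0, by simp⟩
    hf.continuousOn
  have hK : IsCompact (Set.Icc (0 : ℝ) 1 ∩ f ⁻¹' {f t}) :=
    isCompact_Icc.inter_right (isClosed_singleton.preimage hf)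
  obtain ⟨u, ⟨hu, hut⟩, hub⟩ := hK.exists_isGreatest ⟨t, ht, rfl⟩
  rw [Set.mem_preimage, Set.mem_singleton_iff] at hut
  refine ⟨u, hu, fun s hs => hut ▸ hmin hs, fun s hs hus => ?_⟩
  rw [hut]
  exact (hmin hs).lt_of_ne fun h => (hub ⟨hs, h.symm⟩).not_gt hus

theorem exists_first_min {f : ℝ → ℝ} (hf : Continuous f) : ∃ t ∈ Set.Icc (0 : ℝ) 1,
    (∀ s ∈ Set.Icc (0 : ℝ) 1, f t ≤ f s) ∧ ∀ s ∈ Set.Icc (0 : ℝ) 1, s < t → f t < f s := by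
  obtain ⟨t, ht, h1, h2⟩ := exists_last_min (f := fun t => f (1 - t)) (by fun_prop)
  refine ⟨1 - t, ⟨by linarith [ht.2], by linarith [ht.1]⟩, fun s hs => ?_, fun s hs hst => ?_⟩
  · simpa using h1 (1 - s) ⟨by linarith [hs.2], by linarith [hs.1]⟩
  · simpa using h2 (1 - s) ⟨by linarith [hs.2], by linarith [hs.1]⟩ (by linarith)

theorem exists_last_of_int {P : ℤ → Prop} {n m : ℤ} (hnm : n ≤ m) (hn : P n) (hm : ¬ P (m + 1)) :
    ∃ k, n ≤ k ∧ k ≤ m ∧ P k ∧ ¬ P (k + 1) := by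
  induction m, hnm using Int.leInduction with
  | base => exact ⟨n, le_rfl, le_rfl, hn, hm⟩
  | succ m hnm ih =>
    by_cases h : P (m + 1)
    · exact ⟨m + 1, by omega, le_rfl, h, hm⟩
    · obtain ⟨k, h1, h2, h3⟩ := ih h
      exact ⟨k, h1, by omega, h3⟩

/-! ### Paths encoded by integer sequences -/

/-- On the range of indices `n, …, m`, all coefficients governing the directions
`x m, …, x n` are non-negative, and those at the possible breaks are positive. -/
structure IsPosWindow (a b n m : ℤ) : Prop where
  le : n ≤ m
  pos : ∀ j, n < j → j ≤ m → 0 < orbitCoeff a b j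
  left : 0 ≤ orbitCoeff a b n
  right : 0 ≤ orbitCoeff a b (m + 1)

/-- The sequence `c` encodes a path with directions among `x m, …, x n`: the direction changes
from `x j` to `x (j - 1)` at the time `c j / p j`, and these times do not decrease as `j` decreases.
Only the values `c j` for `n < j ≤ m` are relevant. -/
structure IsBreakSeq (a b n m : ℤ) (c : ℤ → ℤ) : Prop where
  nonneg : ∀ j, n < j → j ≤ m → 0 ≤ c j
  le : ∀ j, n < j → j ≤ m → c j ≤ orbitCoeff a b j
  mono : ∀ j, n < j → j < m → c (j + 1) * orbitCoeff a b j ≤ c j * orbitCoeff a b (j + 1)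

/-- The time at which the direction changes from `x j` to `x (j - 1)`, so that `x j` is the
direction between the break times of `j + 1` and `j`. -/
def breakTime (a b n m : ℤ) (c : ℤ → ℤ) (j : ℤ) : ℚ :=
  if j ≤ n then 1 else if m < j then 0 else c j / orbitCoeff a b j

/-- The path with break times `c j / p j`.  The direction changes by `p j • α` at the `j`-th
break, so the path arises from the straight one in the last direction `x n` by adding a
correction for each break. -/
noncomputable def windowFun (a b n m : ℤ) (c : ℤ → ℤ) (t : ℝ) : RealWeight :=
  t • toReal (orbitWeight a b n) - ∑ j ∈ Finset.Ioc n m,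
    min (orbitCoeff a b j * t) (c j : ℝ) • toReal (simpleRoot a b (descent j))

/-- The restriction of `windowFun` to the unit interval. -/
noncomputable def windowPath (a b n m : ℤ) (c : ℤ → ℤ) : Path := fun t => windowFun a b n m c t

section Window

variable {a b n m : ℤ} {c : ℤ → ℤ}

theorem toReal_add_smul (μ ν : Weight) (z : ℤ) :
    toReal (μ + z • ν) = toReal μ + (z : ℝ) • toReal ν := by
  ext i; simp [toReal]

theorem toReal_orbitWeight_eq_add_sum (a b : ℤ) {n k : ℤ} (h : n ≤ k) :
    toReal (orbitWeight a b n) = toReal (orbitWeight a b k) + ∑ j ∈ Finset.Ioc n k,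
      (orbitCoeff a b j : ℝ) • toReal (simpleRoot a b (descent j)) := by
  induction k, h using Int.leInduction with
  | base => simp
  | succ k hk ih =>
    have h1 := orbitWeight_sub_one a b (k + 1)
    rw [add_sub_cancel_right] at h1
    rw [ih, h1, toReal_add_smul, ← Finset.insert_Ioc_right_eq_Ioc_add_one hk,
      Finset.sum_insert (by simp)]
    abel

theorem breakTime_of_le {j : ℤ} (h : j ≤ n) : breakTime a b n m c j = 1 := if_pos h

theorem IsPosWindow.breakTime_of_lt (hw : IsPosWindow a b n m) {j : ℤ} (h : m < j) :
    breakTime a b n m c j = 0 := by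
  have := hw.le
  rw [breakTime, if_neg (by omega), if_pos h]

theorem IsPosWindow.coeff_mul_breakTime (hw : IsPosWindow a b n m) {j : ℤ} (h1 : n < j)
    (h2 : j ≤ m) : orbitCoeff a b j * breakTime a b n m c j = c j := by
  have : (orbitCoeff a b j : ℚ) ≠ 0 := by exact_mod_cast (hw.pos j h1 h2).ne'
  rw [breakTime, if_neg (by omega), if_neg (by omega)]
  field_simp

theorem IsPosWindow.coeff_mul_breakTime_real (hw : IsPosWindow a b n m) {j : ℤ} (h1 : n < j)
    (h2 : j ≤ m) : (orbitCoeff a b j : ℝ) * (breakTime a b n m c j : ℝ) = c j := by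
  exact_mod_cast congrArg (Rat.cast : ℚ → ℝ) (hw.coeff_mul_breakTime (c := c) h1 h2)

theorem IsBreakSeq.breakTime_nonneg (hc : IsBreakSeq a b n m c) (hw : IsPosWindow a b n m)
    (j : ℤ) : 0 ≤ breakTime a b n m c j := by
  rw [breakTime]
  split_ifs with h1 h2
  · exact zero_le_one
  · exact le_rfl
  · have h3 : (0 : ℚ) < orbitCoeff a b j := by exact_mod_cast hw.pos j (by omega) (by omega)
    have h4 : (0 : ℚ) ≤ c j := by exact_mod_cast hc.nonneg j (by omega) (by omega)
    positivity

theorem IsBreakSeq.breakTime_le_one (hc : IsBreakSeq a b n m c) (hw : IsPosWindow a b n m)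
    (j : ℤ) : breakTime a b n m c j ≤ 1 := by
  rw [breakTime]
  split_ifs with h1 h2
  · exact le_rfl
  · exact zero_le_one
  · have h3 : (0 : ℚ) < orbitCoeff a b j := by exact_mod_cast hw.pos j (by omega) (by omega)
    have h4 : (c j : ℚ) ≤ orbitCoeff a b j := by exact_mod_cast hc.le j (by omega) (by omega)
    exact div_le_one_of_le₀ h4 h3.le

theorem IsBreakSeq.breakTime_antitone (hc : IsBreakSeq a b n m c) (hw : IsPosWindow a b n m) :
    Antitone (breakTime a b n m c) := by
  refine antitone_int_of_succ_le fun j => ?_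
  rcases le_or_gt j n with h1 | h1
  · rw [breakTime_of_le h1]; exact hc.breakTime_le_one hw _
  rcases lt_or_ge j m with h2 | h2
  · rw [breakTime, breakTime, if_neg (by omega), if_neg (by omega), if_neg (by omega),
      if_neg (by omega)]
    have h3 : (0 : ℚ) < orbitCoeff a b j := by exact_mod_cast hw.pos j h1 h2.le
    have h4 : (0 : ℚ) < orbitCoeff a b (j + 1) := by
      exact_mod_cast hw.pos (j + 1) (by omega) (by omega)
    rw [div_le_div_iff₀ h4 h3]
    exact_mod_cast hc.mono j h1 h2
  · rw [hw.breakTime_of_lt (j := j + 1) (by omega)]; exact hc.breakTime_nonneg hw _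

theorem IsBreakSeq.breakTime_antitone_real (hc : IsBreakSeq a b n m c)
    (hw : IsPosWindow a b n m) : Antitone fun j => (breakTime a b n m c j : ℝ) :=
  fun _ _ h => Rat.cast_le.mpr (hc.breakTime_antitone hw h)

theorem IsBreakSeq.breakTime_mem_Icc (hc : IsBreakSeq a b n m c) (hw : IsPosWindow a b n m)
    (j : ℤ) : (breakTime a b n m c j : ℝ) ∈ Set.Icc (0 : ℝ) 1 :=
  ⟨by exact_mod_cast hc.breakTime_nonneg hw j, by exact_mod_cast hc.breakTime_le_one hw j⟩

/-- The path between two consecutive breaks. -/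
theorem IsBreakSeq.windowFun_eq (hc : IsBreakSeq a b n m c) (hw : IsPosWindow a b n m)
    {k : ℤ} (h1 : n ≤ k) (h2 : k ≤ m) {t : ℝ} (ht1 : (breakTime a b n m c (k + 1) : ℝ) ≤ t)
    (ht2 : t ≤ breakTime a b n m c k) : windowFun a b n m c t =
      t • toReal (orbitWeight a b k) - ∑ j ∈ Finset.Ioc k m,
        (c j : ℝ) • toReal (simpleRoot a b (descent j)) := by
  have hu := hc.breakTime_antitone_real hw
  rw [windowFun, toReal_orbitWeight_eq_add_sum a b h1, ← Finset.Ioc_union_Ioc_eq_Ioc h1 h2,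
    Finset.sum_union (Finset.Ioc_disjoint_Ioc_of_le le_rfl)]
  have e1 : ∑ j ∈ Finset.Ioc n k, min (orbitCoeff a b j * t) (c j : ℝ) •
      toReal (simpleRoot a b (descent j)) = t • ∑ j ∈ Finset.Ioc n k,
      (orbitCoeff a b j : ℝ) • toReal (simpleRoot a b (descent j)) := by
    rw [Finset.smul_sum]
    refine Finset.sum_congr rfl fun j hj => ?_
    rw [Finset.mem_Ioc] at hj
    have hp : (0 : ℝ) < orbitCoeff a b j := by exact_mod_cast hw.pos j hj.1 (by omega)
    rw [smul_smul, min_eq_left, mul_comm t]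
    rw [← hw.coeff_mul_breakTime_real (c := c) hj.1 (by omega)]
    have := hu hj.2
    exact mul_le_mul_of_nonneg_left (ht2.trans this) hp.le
  have e2 : ∑ j ∈ Finset.Ioc k m, min (orbitCoeff a b j * t) (c j : ℝ) •
      toReal (simpleRoot a b (descent j)) = ∑ j ∈ Finset.Ioc k m,
      (c j : ℝ) • toReal (simpleRoot a b (descent j)) := by
    refine Finset.sum_congr rfl fun j hj => ?_
    rw [Finset.mem_Ioc] at hj
    have hp : (0 : ℝ) < orbitCoeff a b j := by exact_mod_cast hw.pos j (by omega) hj.2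
    rw [min_eq_right]
    rw [← hw.coeff_mul_breakTime_real (c := c) (by omega) hj.2]
    have := hu (show k + 1 ≤ j by omega)
    exact mul_le_mul_of_nonneg_left (this.trans ht1) hp.le
  rw [e1, e2, smul_add]
  abel

/-- Raising `c k` by one subtracts a multiple of a simple root that grows from `0` to `1`. -/
theorem windowFun_add_single {k : ℤ} (h1 : n < k) (h2 : k ≤ m) (t : ℝ) :
    windowFun a b n m (c + Pi.single k 1) t = windowFun a b n m c t -
      (min (orbitCoeff a b k * t) (c k + 1 : ℝ) - min (orbitCoeff a b k * t) (c k : ℝ)) •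
        toReal (simpleRoot a b (descent k)) := by
  rw [windowFun, windowFun, sub_sub, sub_right_inj, ← sub_eq_iff_eq_add', ← Finset.sum_sub_distrib]
  rw [Finset.sum_eq_single k]
  · rw [← sub_smul]; simp
  · intro j _ hj
    simp [hj]
  · intro h
    exact absurd (Finset.mem_Ioc.mpr ⟨h1, h2⟩) h

theorem continuous_windowFun (i : Fin 2) : Continuous fun t => windowFun a b n m c t i := by
  simp only [windowFun, Pi.sub_apply, Finset.sum_apply, Pi.smul_apply]
  fun_prop

theorem IsBreakSeq.windowFun_sub (hc : IsBreakSeq a b n m c) (hw : IsPosWindow a b n m)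
    {k : ℤ} (h1 : n ≤ k) (h2 : k ≤ m) {s t : ℝ} (hs1 : (breakTime a b n m c (k + 1) : ℝ) ≤ s)
    (hs2 : s ≤ breakTime a b n m c k) (ht1 : (breakTime a b n m c (k + 1) : ℝ) ≤ t)
    (ht2 : t ≤ breakTime a b n m c k) (i : Fin 2) :
    windowFun a b n m c t i = windowFun a b n m c s i + (t - s) * orbitWeight a b k i := by
  rw [hc.windowFun_eq hw h1 h2 hs1 hs2, hc.windowFun_eq hw h1 h2 ht1 ht2]
  simp only [Pi.sub_apply, Pi.smul_apply, toReal, smul_eq_mul]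
  ring

/-- The height falls with slope `p k` in the direction `x k`. -/
theorem IsBreakSeq.height_descent (hc : IsBreakSeq a b n m c) (hw : IsPosWindow a b n m)
    {k : ℤ} (h1 : n ≤ k) (h2 : k ≤ m) {s t : ℝ} (hs1 : (breakTime a b n m c (k + 1) : ℝ) ≤ s)
    (hs2 : s ≤ breakTime a b n m c k) (ht1 : (breakTime a b n m c (k + 1) : ℝ) ≤ t)
    (ht2 : t ≤ breakTime a b n m c k) : windowFun a b n m c t (descent k) =
      windowFun a b n m c s (descent k) - (t - s) * orbitCoeff a b k := by
  rw [hc.windowFun_sub hw h1 h2 hs1 hs2 ht1 ht2, orbitWeight_apply_descent]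
  push_cast; ring

/-- The other height rises with slope `p (k + 1)` in the direction `x k`. -/
theorem IsBreakSeq.height_ascent (hc : IsBreakSeq a b n m c) (hw : IsPosWindow a b n m)
    {k : ℤ} (h1 : n ≤ k) (h2 : k ≤ m) {s t : ℝ} (hs1 : (breakTime a b n m c (k + 1) : ℝ) ≤ s)
    (hs2 : s ≤ breakTime a b n m c k) (ht1 : (breakTime a b n m c (k + 1) : ℝ) ≤ t)
    (ht2 : t ≤ breakTime a b n m c k) : windowFun a b n m c t (descent (k + 1)) =
      windowFun a b n m c s (descent (k + 1)) + (t - s) * orbitCoeff a b (k + 1) := by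
  rw [hc.windowFun_sub hw h1 h2 hs1 hs2 ht1 ht2, orbitWeight_apply_descent_add_one]

/-- The local minima of the height, and its values at the ends, are integers. -/
theorem IsBreakSeq.height_breakTime_int (hc : IsBreakSeq a b n m c) (hw : IsPosWindow a b n m)
    {k : ℤ} (h1 : n ≤ k) (h2 : k ≤ m + 1) :
    ∃ z : ℤ, windowFun a b n m c (breakTime a b n m c k) (descent k) = z := by
  rcases h2.eq_or_lt with rfl | h2
  · rw [hw.breakTime_of_lt (lt_add_one m), hc.windowFun_eq hw hw.le le_rfl
      (by rw [hw.breakTime_of_lt (lt_add_one m)]) (by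
        have := (hc.breakTime_mem_Icc hw m).1; simpa using this)]
    exact ⟨0, by simp⟩
  have hk : ∃ z : ℤ, (orbitCoeff a b k : ℝ) * (breakTime a b n m c k : ℝ) = z := by
    rcases h1.eq_or_lt with rfl | h1
    · exact ⟨orbitCoeff a b n, by simp [breakTime_of_le (le_refl n)]⟩
    · exact ⟨c k, hw.coeff_mul_breakTime_real h1 (by omega)⟩
  obtain ⟨z, hz⟩ := hk
  rw [hc.windowFun_eq hw h1 (by omega) (hc.breakTime_antitone_real hw (by omega)) le_rfl]
  refine ⟨-z - ∑ j ∈ Finset.Ioc k m, c j * simpleRoot a b (descent j) (descent k), ?_⟩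
  simp only [Pi.sub_apply, Pi.smul_apply, Finset.sum_apply, toReal, smul_eq_mul,
    orbitWeight_apply_descent]
  push_cast
  rw [← hz]
  ring

theorem IsBreakSeq.height_one_int (hc : IsBreakSeq a b n m c) (hw : IsPosWindow a b n m)
    (i : Fin 2) : ∃ z : ℤ, windowFun a b n m c 1 i = z := by
  have e : breakTime a b n m c n = 1 := breakTime_of_le le_rfl
  rw [hc.windowFun_eq hw le_rfl hw.le (hc.breakTime_mem_Icc hw _).2 (by rw [e]; simp)]
  refine ⟨orbitWeight a b n i - ∑ j ∈ Finset.Ioc n m, c j * simpleRoot a b (descent j) i, ?_⟩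
  simp [toReal]

/-! ### Root operators on encoded paths -/

/-- If the height has its last minimum at the `k`-th break, then `f` moves this break by one unit,
provided that the result is still encoded by a sequence. -/
theorem IsBreakSeq.rootF_windowPath (hc : IsBreakSeq a b n m c) (hw : IsPosWindow a b n m)
    {k : ℤ} (h1 : n < k) (h2 : k ≤ m) (hc' : IsBreakSeq a b n m (c + Pi.single k 1))
    (hmin : ∀ t ∈ Set.Icc (0 : ℝ) 1, windowFun a b n m c (breakTime a b n m c k) (descent k)
      ≤ windowFun a b n m c t (descent k))
    (hlast : ∀ t ∈ Set.Icc (0 : ℝ) 1, (breakTime a b n m c k : ℝ) < t →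
      windowFun a b n m c (breakTime a b n m c k) (descent k)
        < windowFun a b n m c t (descent k)) :
    rootF a b (descent k) (windowPath a b n m c) =
      some (windowPath a b n m (c + Pi.single k 1)) := by
  have hp : (0 : ℝ) < orbitCoeff a b k := by exact_mod_cast hw.pos k h1 h2
  have hck := hw.coeff_mul_breakTime_real (c := c) h1 h2
  set t₀ : unitInterval := ⟨breakTime a b n m c k, hc.breakTime_mem_Icc hw k⟩ with ht₀
  set t₁ : unitInterval := ⟨breakTime a b n m (c + Pi.single k 1) k,
    hc'.breakTime_mem_Icc hw k⟩ with ht₁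
  have hck' : (orbitCoeff a b k : ℝ) * (t₁ : ℝ) = c k + 1 := by
    have := hw.coeff_mul_breakTime_real (c := c + Pi.single k 1) h1 h2
    simpa using this
  have hck : (orbitCoeff a b k : ℝ) * (t₀ : ℝ) = c k := hck
  have h01 : (t₀ : ℝ) < t₁ := by nlinarith
  -- The moved break does not pass the next one, so the direction is constant on `[t₀, t₁]`.
  have hnext : (t₁ : ℝ) ≤ breakTime a b n m c (k - 1) := by
    have h3 := hc'.breakTime_antitone_real hw (show k - 1 ≤ k by omega)
    refine (le_of_eq_of_le rfl h3).trans (le_of_eq ?_)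
    simp [breakTime]
  have hslope : ∀ t : unitInterval, t₀ ≤ t → t ≤ t₁ →
      height (descent k) (windowPath a b n m c) t =
        height (descent k) (windowPath a b n m c) t₀ + orbitCoeff a b k * ((t : ℝ) - t₀) := by
    intro t h3 h4
    have h3' : (t₀ : ℝ) ≤ t := h3
    have h4' : (t : ℝ) ≤ t₁ := h4
    have := hc.height_ascent hw (k := k - 1) (s := t₀) (t := t) (by omega) (by omega)
      (by rw [sub_add_cancel]) (h01.le.trans hnext) (by rwa [sub_add_cancel])
      (h4'.trans hnext)
    rw [sub_add_cancel] at this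
    simp only [height, windowPath]
    rw [this]
    ring
  rw [rootF_eq_some a b (descent k) (windowPath a b n m c) (t₀ := t₀) (t₁ := t₁) hp
    (fun t => hmin t t.2) (fun t ht => hlast t t.2 ht) hslope (by rw [mul_sub, hck, hck']; ring)]
  · congr 1
    funext t
    simp only [windowPath]
    rw [windowFun_add_single h1 h2]
    split_ifs with h3 h4
    · have h3' : (t : ℝ) ≤ t₀ := h3
      have h5 : (orbitCoeff a b k : ℝ) * (t : ℝ) ≤ c k := by nlinarith
      rw [min_eq_left h5, min_eq_left (by linarith)]
      simp
    · have h3' : (t₀ : ℝ) < t := not_le.mp h3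
      have h4' : (t : ℝ) ≤ t₁ := h4
      rw [min_eq_left (by nlinarith), min_eq_right (by nlinarith), mul_sub, hck]
    · have h4' : (t₁ : ℝ) < t := not_le.mp h4
      rw [min_eq_right (by nlinarith), min_eq_right (by nlinarith)]
      simp
  · obtain ⟨y, hy⟩ := hc.height_one_int hw (descent k)
    obtain ⟨z, hz⟩ := hc.height_breakTime_int hw h1.le (by omega : k ≤ m + 1)
    have h3 := hlast 1 (by simp) (lt_of_lt_of_le h01 t₁.2.2)
    simp only [height, windowPath, Set.Icc.coe_one, ht₀]
    rw [hy, hz] at h3 ⊢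
    have h4 : z < y := by exact_mod_cast h3
    have h5 : z + 1 ≤ y := h4
    have h6 : (z : ℝ) + 1 ≤ y := by exact_mod_cast h5
    linarith

theorem add_one_le_of_int {x y : ℝ} (hx : ∃ z : ℤ, x = z) (hy : ∃ z : ℤ, y = z) (h : x < y) :
    x + 1 ≤ y := by
  obtain ⟨z, rfl⟩ := hx
  obtain ⟨w, rfl⟩ := hy
  have h1 : z < w := by exact_mod_cast h
  have h2 : z + 1 ≤ w := h1
  exact_mod_cast h2

theorem IsBreakSeq.breakTime_eq_zero_or_one (hc : IsBreakSeq a b n m c)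
    (hw : IsPosWindow a b n m) {j : ℤ} (h1 : n < j) (h2 : j ≤ m) (hp : orbitCoeff a b j = 1) :
    breakTime a b n m c j = 0 ∨ breakTime a b n m c j = 1 := by
  have h3 := hw.coeff_mul_breakTime (c := c) h1 h2
  have h4 := hc.nonneg j h1 h2
  have h5 := hc.le j h1 h2
  rw [hp] at h3 h5
  have h6 : c j = 0 ∨ c j = 1 := by omega
  rw [Int.cast_one, one_mul] at h3
  rcases h6 with h | h <;> simp [h3, h]

/-- If `p m = 1`, a path with directions among `x m, …, x n` other than the straight one in the
direction `x m` has a height increasing at its end, and the corresponding `f` moves a break: the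
one at the last minimum of the height.  This break stays before the next one since the height at
the break after that is an integer above the minimum.  The condition `p m = 1` rules out that the
height has its last minimum at time `0`, where `f` would introduce the direction `x (m + 1)`. -/
theorem IsBreakSeq.exists_rootF_eq_add_single (hc : IsBreakSeq a b n m c)
    (hw : IsPosWindow a b n m) (hpm : orbitCoeff a b m = 1)
    (hne : ∃ j, n < j ∧ j ≤ m ∧ c j ≠ orbitCoeff a b j) :
    ∃ k, n < k ∧ k ≤ m ∧ IsBreakSeq a b n m (c + Pi.single k 1) ∧
      rootF a b (descent k) (windowPath a b n m c) =
        some (windowPath a b n m (c + Pi.single k 1)) := by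
  have hanti := hc.breakTime_antitone hw
  have hantiR := hc.breakTime_antitone_real hw
  have hUn : breakTime a b n m c n = 1 := breakTime_of_le le_rfl
  have hUm1 : breakTime a b n m c (m + 1) = 0 := hw.breakTime_of_lt (by omega)
  have hnn : ∀ k, n ≤ k → k ≤ m → (0 : ℝ) ≤ orbitCoeff a b k := by
    intro k h1 h2
    rcases h1.eq_or_lt with rfl | h1
    · exact_mod_cast hw.left
    · exact_mod_cast (hw.pos k h1 h2).le
  have hUm : breakTime a b n m c m = 0 := by
    obtain ⟨j, h1, h2, h3⟩ := hne
    refine (hc.breakTime_eq_zero_or_one hw (by omega) le_rfl hpm).resolve_right fun h => h3 ?_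
    have h4 : breakTime a b n m c j = 1 :=
      le_antisymm (hc.breakTime_le_one hw j) (h ▸ hanti h2)
    have h5 := hw.coeff_mul_breakTime (c := c) h1 h2
    rw [h4, mul_one] at h5
    exact_mod_cast h5.symm
  -- The index `i` is chosen so that the height increases in the last direction.
  obtain ⟨k₀, hk1, hk2, hk3, hk4⟩ := exists_last_of_int (P := fun k => 1 ≤ breakTime a b n m c k)
    hw.le hUn.ge (by rw [hUm1]; norm_num)
  have hk5 : k₀ < m := by
    refine lt_of_le_of_ne hk2 ?_
    rintro rfl
    rw [hUm] at hk3
    norm_num at hk3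
  obtain ⟨t₀, ht₀, hmin, hlast⟩ := exists_last_min
    (continuous_windowFun (a := a) (b := b) (n := n) (m := m) (c := c) (descent (k₀ + 1)))
  have ht1 : t₀ < 1 := by
    refine lt_of_le_of_ne ht₀.2 ?_
    rintro rfl
    have h1 : (breakTime a b n m c (k₀ + 1) : ℝ) < 1 := by exact_mod_cast not_le.mp hk4
    have h2 : (1 : ℝ) ≤ breakTime a b n m c k₀ := by exact_mod_cast hk3
    have h3 := hc.height_ascent hw hk1 hk2 le_rfl (h1.le.trans h2) h1.le h2
    have h4 := hmin _ (hc.breakTime_mem_Icc hw (k₀ + 1))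
    have h5 : (0 : ℝ) < orbitCoeff a b (k₀ + 1) := by
      exact_mod_cast hw.pos (k₀ + 1) (by omega) (by omega)
    nlinarith
  generalize descent (k₀ + 1) = i at hmin hlast
  obtain ⟨k, hn, hm, hlt, hle⟩ := exists_last_of_int
    (P := fun k => t₀ < (breakTime a b n m c k : ℝ)) hw.le (by simpa [hUn] using ht1)
    (by simpa [hUm1] using ht₀.1)
  rw [not_lt] at hle
  have hkm : k < m := by
    refine lt_of_le_of_ne hm ?_
    rintro rfl
    simp only [hUm, Rat.cast_zero] at hlt
    linarith [ht₀.1]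
  have hp : (0 : ℝ) < orbitCoeff a b (k + 1) := by
    exact_mod_cast hw.pos (k + 1) (by omega) (by omega)
  rcases descent_eq_or i k with rfl | rfl
  · have h1 := hc.height_descent hw hn hm hle hlt.le (hle.trans hlt.le) le_rfl
    have h2 := hlast _ (hc.breakTime_mem_Icc hw k) hlt
    have h3 := hnn k hn hm
    nlinarith
  have ht : t₀ = breakTime a b n m c (k + 1) := by
    refine (hle.eq_or_lt.resolve_right fun h => ?_).symm
    have h1 := hc.height_ascent hw hn hm hle hlt.le le_rfl (h.le.trans hlt.le)
    have h2 := hmin _ (hc.breakTime_mem_Icc hw (k + 1))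
    nlinarith
  subst ht
  have hcU := hw.coeff_mul_breakTime_real (c := c) (j := k + 1) (by omega) (by omega)
  have hbr : IsBreakSeq a b n m (c + Pi.single (k + 1) 1) := by
    refine ⟨fun j h1 h2 => ?_, fun j h1 h2 => ?_, fun j h1 h2 => ?_⟩
    · have := hc.nonneg j h1 h2
      by_cases hj : j = k + 1
      · subst hj; simp; omega
      · simpa [hj] using this
    · by_cases hj : j = k + 1
      · subst hj
        have h3 : (c (k + 1) : ℝ) < orbitCoeff a b (k + 1) := by
          rw [← hcU]; nlinarith
        have h4 : c (k + 1) < orbitCoeff a b (k + 1) := by exact_mod_cast h3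
        simpa using h4
      · simpa [hj] using hc.le j h1 h2
    · have h3 := hc.mono j h1 h2
      by_cases hj : j = k + 1
      · subst hj
        have := hw.pos (k + 1 + 1) (by omega) (by omega)
        simp
        nlinarith
      by_cases hj' : j = k
      · subst hj'
        -- The height at the break `j - 1` is an integer above the minimum.
        have e : descent (j - 1) = descent (j + 1) := by
          rw [← descent_add_two (j - 1)]; congr 1; ring
        have hanti' := hantiR (show j - 1 ≤ j by omega)
        have h4 := hlast _ (hc.breakTime_mem_Icc hw (j - 1)) (hlt.trans_le hanti')
        have h5 := hc.height_breakTime_int hw (k := j - 1) (by omega) (by omega)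
        rw [e] at h5
        have h6 := add_one_le_of_int (hc.height_breakTime_int hw (k := j + 1) (by omega)
          (by omega)) h5 h4
        have h7 := hc.height_descent hw (k := j - 1) (by omega) (by omega)
          (s := breakTime a b n m c j) (t := breakTime a b n m c (j - 1))
          (by rw [sub_add_cancel]) hanti' (by rw [sub_add_cancel]; exact hanti') le_rfl
        rw [e] at h7
        have h8 := hc.height_ascent hw (k := j) (by omega) (by omega)
          (s := breakTime a b n m c (j + 1)) (t := breakTime a b n m c j) le_rfl hlt.le hlt.le
          le_rfl
        have h9 := hnn (j - 1) (by omega) (by omega)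
        have h10 : (c (j + 1) : ℝ) + 1 ≤ breakTime a b n m c j * orbitCoeff a b (j + 1) := by
          have h11 : 0 ≤ ((breakTime a b n m c (j - 1) : ℝ) - breakTime a b n m c j)
              * orbitCoeff a b (j - 1) := mul_nonneg (sub_nonneg.mpr hanti') h9
          nlinarith
        have h12 := hw.coeff_mul_breakTime_real (c := c) (j := j) h1 h2.le
        have h13 : (0 : ℝ) < orbitCoeff a b j := by exact_mod_cast hw.pos j h1 h2.le
        have h14 : ((c (j + 1) : ℝ) + 1) * orbitCoeff a b j ≤ c j * orbitCoeff a b (j + 1) := by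
          rw [← h12]; nlinarith
        simp
        exact_mod_cast h14
      · have h4 : j + 1 ≠ k + 1 := by omega
        simpa [hj, h4] using h3
  exact ⟨k + 1, by omega, by omega, hbr,
    hc.rootF_windowPath hw (by omega) (by omega) hbr hmin hlast⟩

/-- If `p (n + 1) = 1`, a path with directions among `x m, …, x n` other than the straight one in
the direction `x n` has a height decreasing at its start, and it arises by the corresponding `f`
from the path in which a break is moved back: the one at the first minimum of the height.  The
moved break stays after the preceding one since the height at the break before that is an integer
above the minimum.  The condition `p (n + 1) = 1` ensures that the direction `x n` does not occur,
so that the minimum is at one of the breaks considered. -/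
theorem IsBreakSeq.exists_rootF_sub_single_eq (hc : IsBreakSeq a b n m c)
    (hw : IsPosWindow a b n m) (hpn : orbitCoeff a b (n + 1) = 1)
    (hne : ∃ j, n < j ∧ j ≤ m ∧ c j ≠ 0) :
    ∃ k, n < k ∧ k ≤ m ∧ IsBreakSeq a b n m (c - Pi.single k 1) ∧
      rootF a b (descent k) (windowPath a b n m (c - Pi.single k 1)) =
        some (windowPath a b n m c) := by
  have hanti := hc.breakTime_antitone hw
  have hantiR := hc.breakTime_antitone_real hw
  have hUn : breakTime a b n m c n = 1 := breakTime_of_le le_rfl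
  have hUm1 : breakTime a b n m c (m + 1) = 0 := hw.breakTime_of_lt (by omega)
  have hnn : ∀ k, n < k → k ≤ m + 1 → (0 : ℝ) ≤ orbitCoeff a b k := by
    intro k h1 h2
    rcases h2.eq_or_lt with rfl | h2
    · exact_mod_cast hw.right
    · exact_mod_cast (hw.pos k h1 (by omega)).le
  have hUn1 : breakTime a b n m c (n + 1) = 1 := by
    obtain ⟨j, h1, h2, h3⟩ := hne
    refine (hc.breakTime_eq_zero_or_one hw (by omega) (by omega) hpn).resolve_left
      fun h => h3 ?_
    have h4 : breakTime a b n m c j = 0 :=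
      le_antisymm (h ▸ hanti (show n + 1 ≤ j by omega)) (hc.breakTime_nonneg hw j)
    have h5 := hw.coeff_mul_breakTime (c := c) h1 h2
    rw [h4, mul_zero] at h5
    exact_mod_cast h5.symm
  -- The index `i` is chosen so that the height decreases in the first direction.
  obtain ⟨k₀, hk1, hk2, hk3, hk4⟩ := exists_last_of_int (P := fun k => 0 < breakTime a b n m c k)
    hw.le (by rw [hUn]; exact one_pos) (by rw [hUm1]; exact lt_irrefl _)
  have hk5 : n < k₀ := by
    refine lt_of_le_of_ne hk1 ?_
    rintro rfl
    rw [hUn1] at hk4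
    norm_num at hk4
  obtain ⟨t₀, ht₀, hmin, hfirst⟩ := exists_first_min
    (continuous_windowFun (a := a) (b := b) (n := n) (m := m) (c := c) (descent k₀))
  have ht0 : 0 < t₀ := by
    refine lt_of_le_of_ne ht₀.1 ?_
    rintro rfl
    have h1 : (breakTime a b n m c (k₀ + 1) : ℝ) ≤ 0 := by exact_mod_cast not_lt.mp hk4
    have h2 : (0 : ℝ) < breakTime a b n m c k₀ := by exact_mod_cast hk3
    have h3 := hc.height_descent hw hk1 hk2 h1 h2.le (h1.trans h2.le) le_rfl
    have h4 := hmin _ (hc.breakTime_mem_Icc hw k₀)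
    have h5 : (0 : ℝ) < orbitCoeff a b k₀ := by exact_mod_cast hw.pos k₀ hk5 hk2
    nlinarith
  generalize descent k₀ = i at hmin hfirst
  obtain ⟨k, hn, hm, hle, hlt⟩ := exists_last_of_int
    (P := fun k => t₀ ≤ (breakTime a b n m c k : ℝ)) hw.le (by simpa [hUn] using ht₀.2)
    (by simpa [hUm1] using ht0)
  rw [not_le] at hlt
  have hnk : n < k := by
    refine lt_of_le_of_ne hn ?_
    rintro rfl
    simp only [hUn1, Rat.cast_one] at hlt
    linarith [ht₀.2]
  have hp : (0 : ℝ) < orbitCoeff a b k := by exact_mod_cast hw.pos k hnk hm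
  rcases descent_eq_or i k with rfl | rfl
  swap
  · have h1 := hc.height_ascent hw hn hm hlt.le hle le_rfl (hlt.le.trans hle)
    have h2 := hfirst _ (hc.breakTime_mem_Icc hw (k + 1)) hlt
    have h3 := hnn (k + 1) (by omega) (by omega)
    nlinarith
  have ht : t₀ = breakTime a b n m c k := by
    refine hle.eq_or_lt.resolve_right fun h => ?_
    have h1 := hc.height_descent hw hn hm hlt.le hle (hlt.le.trans hle) le_rfl
    have h2 := hmin _ (hc.breakTime_mem_Icc hw k)
    nlinarith
  subst ht
  have hcU := hw.coeff_mul_breakTime_real (c := c) (j := k) hnk hm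
  have hint := hc.height_breakTime_int hw (k := k) hn (by omega)
  have hbefore : ∀ t : ℝ, 0 ≤ t → t ≤ breakTime a b n m c (k + 1) →
      windowFun a b n m c (breakTime a b n m c k) (descent k) + 1 ≤
        windowFun a b n m c t (descent k) := by
    intro t h0 h1
    rcases h0.eq_or_lt with rfl | h0
    · refine add_one_le_of_int hint ⟨0, ?_⟩ (hfirst 0 (by simp) ht0)
      rw [hc.windowFun_eq hw hw.le le_rfl (by simp [hUm1])
        (hc.breakTime_mem_Icc hw m).1]
      simp
    have hkm : k + 1 ≤ m := by
      by_contra h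
      rw [hw.breakTime_of_lt (by omega), Rat.cast_zero] at h1
      linarith
    obtain ⟨l, hl1, hl2, hl3, hl4⟩ := exists_last_of_int
      (P := fun l => t ≤ (breakTime a b n m c l : ℝ)) hkm h1 (by simpa [hUm1] using h0)
    rw [not_le] at hl4
    have hll : (breakTime a b n m c l : ℝ) < breakTime a b n m c k :=
      lt_of_le_of_lt (hantiR hl1) hlt
    rcases descent_eq_or (descent k) l with e | e <;> rw [e] at hint hfirst ⊢
    · have h2 := add_one_le_of_int hint (hc.height_breakTime_int hw (k := l) (by omega)
        (by omega)) (hfirst _ (hc.breakTime_mem_Icc hw l) hll)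
      have h3 := hc.height_descent hw (k := l) (by omega) hl2 hl4.le hl3 (hl4.le.trans hl3) le_rfl
      have h4 := hnn l (by omega) (by omega)
      nlinarith
    · have h2 := add_one_le_of_int hint (hc.height_breakTime_int hw (k := l + 1) (by omega)
        (by omega)) (hfirst _ (hc.breakTime_mem_Icc hw (l + 1)) (hl4.trans_le (hl3.trans hll.le)))
      have h3 := hc.height_ascent hw (k := l) (by omega) hl2 le_rfl (hl4.le.trans hl3) hl4.le hl3
      have h4 := hnn (l + 1) (by omega) (by omega)
      nlinarith
  have hgap : (breakTime a b n m c (k + 1) : ℝ) * orbitCoeff a b k ≤ c k - 1 := by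
    have h1 := hbefore _ (hc.breakTime_mem_Icc hw (k + 1)).1 le_rfl
    have h2 := hc.height_descent hw (k := k) hn hm le_rfl hlt.le hlt.le le_rfl
    nlinarith
  have hbr : IsBreakSeq a b n m (c - Pi.single k 1) := by
    refine ⟨fun j h1 h2 => ?_, fun j h1 h2 => ?_, fun j h1 h2 => ?_⟩
    · by_cases hj : j = k
      · subst hj
        have h3 : (0 : ℝ) < c j := by rw [← hcU]; positivity
        have h4 : 0 < c j := by exact_mod_cast h3
        simp; omega
      · simpa [hj] using hc.nonneg j h1 h2
    · have := hc.le j h1 h2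
      by_cases hj : j = k
      · subst hj; simp; omega
      · simpa [hj] using this
    · have h3 := hc.mono j h1 h2
      by_cases hj : j = k
      · subst hj
        have h4 := hw.coeff_mul_breakTime_real (c := c) (j := j + 1) (by omega) (by omega)
        have h5 := hnn (j + 1) (by omega) (by omega)
        have h6 : (c (j + 1) : ℝ) * orbitCoeff a b j ≤ (c j - 1) * orbitCoeff a b (j + 1) := by
          rw [← h4]; nlinarith
        simp
        exact_mod_cast h6
      by_cases hj' : j + 1 = k
      · subst hj'
        have := hw.pos j h1 (by omega)
        simp
        nlinarith
      · simpa [hj, hj'] using h3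
  refine ⟨k, hnk, hm, hbr, ?_⟩
  -- It remains to find the last minimum of the height of the new path.
  have hcUv := hw.coeff_mul_breakTime_real (c := c - Pi.single k 1) (j := k) hnk hm
  simp only [Pi.sub_apply, Pi.single_eq_same, Int.cast_sub, Int.cast_one] at hcUv
  have hH : ∀ t : ℝ, windowFun a b n m (c - Pi.single k 1) t (descent k) =
      windowFun a b n m c t (descent k) + 2 * (min (orbitCoeff a b k * t) (c k : ℝ) -
        min (orbitCoeff a b k * t) (c k - 1 : ℝ)) := by
    intro t
    have h1 := windowFun_add_single (a := a) (b := b) (c := c - Pi.single k 1) hnk hm t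
    rw [sub_add_cancel] at h1
    rw [h1]
    simp [toReal, simpleRoot_apply_self]
    ring
  set v : ℝ := (breakTime a b n m (c - Pi.single k 1) k : ℝ) with hv
  have hUv : (breakTime a b n m c (k + 1) : ℝ) ≤ v := by
    by_contra h
    nlinarith
  have hvk : v < breakTime a b n m c k := by
    by_contra h
    nlinarith
  have hseg : ∀ t : ℝ, (breakTime a b n m c (k + 1) : ℝ) ≤ t → t ≤ breakTime a b n m c k →
      windowFun a b n m c t (descent k) =
        windowFun a b n m c (breakTime a b n m c k) (descent k) + c k - orbitCoeff a b k * t := by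
    intro t h1 h2
    have h3 := hc.height_descent hw (k := k) hn hm hlt.le le_rfl h1 h2
    rw [h3, ← hcU]
    ring
  have hHv : windowFun a b n m (c - Pi.single k 1) v (descent k) =
      windowFun a b n m c (breakTime a b n m c k) (descent k) + 1 := by
    rw [hH, hseg v hUv hvk.le, min_eq_left (by linarith), min_eq_left (by linarith), hcUv]
    ring
  have hgt : ∀ t ∈ Set.Icc (0 : ℝ) 1, v < t →
      windowFun a b n m (c - Pi.single k 1) v (descent k) <
        windowFun a b n m (c - Pi.single k 1) t (descent k) := by
    intro t h1 h2
    have h5 : (c k : ℝ) - 1 < orbitCoeff a b k * t := by rw [← hcUv]; nlinarith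
    rw [hHv, hH, min_eq_right (a := (orbitCoeff a b k : ℝ) * t) (b := (c k : ℝ) - 1) h5.le]
    rcases le_or_gt t (breakTime a b n m c k : ℝ) with h3 | h3
    · rw [hseg t (hUv.trans h2.le) h3, min_eq_left (by rw [← hcU]; nlinarith)]
      linarith
    · rw [min_eq_right (by rw [← hcU]; nlinarith)]
      have := hmin t h1
      linarith
  have key := hbr.rootF_windowPath hw hnk hm (by rwa [sub_add_cancel]) (fun t h1 => ?_) hgt
  · rwa [sub_add_cancel] at key
  rcases lt_or_ge v t with h2 | h2
  · exact (hgt t h1 h2).le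
  have h5 : (orbitCoeff a b k : ℝ) * t ≤ c k - 1 := by rw [← hcUv]; nlinarith
  rw [← hv, hHv, hH, min_eq_left (by linarith), min_eq_left h5, sub_self, mul_zero, add_zero]
  rcases le_or_gt t (breakTime a b n m c (k + 1) : ℝ) with h3 | h3
  · exact hbefore t h1.1 h3
  · rw [hseg t h3.le (h2.trans hvk.le)]
    linarith

end Window

/-! ### Lakshmibai-Seshadri paths as encoded paths -/

theorem IsPosWindow.of_isOrbitIndex {a b n m : ℤ} (ha : 0 < a) (hb : 0 < b) (hab : 4 < a * b)
    (h : n ≤ m) (hn : IsOrbitIndex a b n) (hm : IsOrbitIndex a b m) : IsPosWindow a b n m where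
  le := h
  pos _ h1 h2 := orbitCoeff_pos ha hb hab (hn.of_mem hm (by omega) (by omega))
    (hn.of_mem hm (by omega) (by omega))
  left := orbitCoeff_nonneg ha hb hab hn
  right := orbitCoeff_add_one_nonneg ha hb hab hm

/-- An encoded path is attached to its directions and break times. -/
theorem IsBreakSeq.isPathOf {a b n m : ℤ} {c : ℤ → ℤ} (hc : IsBreakSeq a b n m c)
    (hw : IsPosWindow a b n m) {M : ℤ} {s : ℕ} {ν : ℕ → Weight} {σ : ℕ → ℚ} (hM : M ≤ m)
    (hs : n + s ≤ M + 1) (hν : ∀ k < s, ν k = orbitWeight a b (M - k))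
    (hσ : ∀ k ≤ s, σ k = breakTime a b n m c (M + 1 - k)) (h0 : σ 0 = 0) :
    IsPathOf (windowPath a b n m c) s ν σ := by
  -- The increments of the path over the linear pieces.
  have key : ∀ k < s, ∀ t : ℝ, (σ k : ℝ) ≤ t → t ≤ (σ (k + 1) : ℝ) →
      windowFun a b n m c t - windowFun a b n m c (σ k : ℝ) = (t - σ k) • toReal (ν k) := by
    intro k hk t h1 h2
    rw [hσ (k + 1) (by omega)] at h2
    rw [hσ k (by omega)] at h1 ⊢
    have e1 : M + 1 - (k : ℤ) = M - k + 1 := by ring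
    have e2 : M + 1 - ((k + 1 : ℕ) : ℤ) = M - k := by push_cast; ring
    rw [e1] at h1 ⊢
    rw [e2] at h2
    ext i
    rw [Pi.sub_apply, hc.windowFun_sub hw (k := M - k) (by omega) (by omega) le_rfl
      (h1.trans h2) h1 h2, hν k hk]
    simp [toReal]
  have hmono : ∀ k < s, (σ k : ℝ) ≤ (σ (k + 1) : ℝ) := by
    intro k hk
    rw [hσ k hk.le, hσ (k + 1) hk]
    exact hc.breakTime_antitone_real hw (by push_cast; omega)
  intro j hj t h1 h2
  have h3 : ∑ k ∈ Finset.range j, ((σ (k + 1) : ℝ) - σ k) • toReal (ν k)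
      = windowFun a b n m c (σ j : ℝ) := by
    have h4 : windowFun a b n m c (σ 0 : ℝ) = 0 := by
      have hU0 : breakTime a b n m c (m + 1) = 0 := hw.breakTime_of_lt (by omega)
      rw [h0, hc.windowFun_eq hw hw.le le_rfl (by simp [hU0]) (by
        have := (hc.breakTime_mem_Icc hw m).1; simpa using this)]
      simp
    rw [← sub_zero (windowFun a b n m c (σ j : ℝ)), ← h4,
      ← Finset.sum_range_sub (fun k => windowFun a b n m c (σ k : ℝ))]
    refine Finset.sum_congr rfl fun k hk => ?_
    have hk' : k < s := (Finset.mem_range.mp hk).trans hj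
    exact (key k hk' _ (hmono k hk') le_rfl).symm
  rw [h3, ← key j hj t h1 h2, windowPath]
  abel

theorem IsPathOf.unique {π π' : Path} {s : ℕ} {ν : ℕ → Weight} {σ : ℕ → ℚ} (hs : 1 ≤ s)
    (h0 : σ 0 = 0) (h1 : σ s = 1) (h : IsPathOf π s ν σ) (h' : IsPathOf π' s ν σ) : π = π' := by
  classical
  funext t
  have hex : ∃ j, (t : ℝ) ≤ σ (j + 1) :=
    ⟨s - 1, by rw [Nat.sub_add_cancel hs, h1, Rat.cast_one]; exact t.2.2⟩
  have hlt : Nat.find hex < s := by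
    have : Nat.find hex ≤ s - 1 :=
      Nat.find_min' hex (by rw [Nat.sub_add_cancel hs, h1, Rat.cast_one]; exact t.2.2)
    omega
  have hle : (σ (Nat.find hex) : ℝ) ≤ t := by
    rcases Nat.eq_zero_or_pos (Nat.find hex) with h | h
    · rw [h, h0, Rat.cast_zero]; exact t.2.1
    · have := Nat.find_min hex (show Nat.find hex - 1 < Nat.find hex by omega)
      rw [Nat.sub_add_cancel h, not_le] at this
      exact this.le
  rw [h _ hlt t hle (Nat.find_spec hex), h' _ hlt t hle (Nat.find_spec hex)]

/-- Encoded paths are Lakshmibai-Seshadri paths.  Two breaks strictly between `0` and `1` cannot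
coincide, by coprimality of consecutive terms of `p`. -/
theorem IsBreakSeq.windowPath_mem {a b n m : ℤ} {c : ℤ → ℤ} (ha : 0 < a) (hb : 0 < b)
    (hab : 4 < a * b) (hc : IsBreakSeq a b n m c) (h : n ≤ m) (hn : IsOrbitIndex a b n)
    (hm : IsOrbitIndex a b m) : windowPath a b n m c ∈
      LSPaths a b (fundamentalWeight 0 - fundamentalWeight 1) := by
  have hw := IsPosWindow.of_isOrbitIndex ha hb hab h hn hm
  have hanti := hc.breakTime_antitone hw
  have hUn : breakTime a b n m c n = 1 := breakTime_of_le le_rfl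
  have hUm1 : breakTime a b n m c (m + 1) = 0 := hw.breakTime_of_lt (by omega)
  obtain ⟨M, hM1, hM2, hM3, hM4⟩ := exists_last_of_int (P := fun k => 0 < breakTime a b n m c k)
    h (by rw [hUn]; exact one_pos) (by rw [hUm1]; exact lt_irrefl _)
  obtain ⟨N, hN1, hN2, hN3, hN4⟩ := exists_last_of_int (P := fun k => 1 ≤ breakTime a b n m c k)
    h hUn.ge (by rw [hUm1]; norm_num)
  replace hM4 : breakTime a b n m c (M + 1) = 0 :=
    le_antisymm (not_lt.mp hM4) (hc.breakTime_nonneg hw _)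
  replace hN3 : breakTime a b n m c N = 1 := le_antisymm (hc.breakTime_le_one hw _) hN3
  rw [not_le] at hN4
  have hNM : N ≤ M := by
    by_contra h'
    have := hanti (show M + 1 ≤ N by omega)
    rw [hM4, hN3] at this
    norm_num at this
  have hlt : ∀ j, N ≤ j → j ≤ M → breakTime a b n m c (j + 1) < breakTime a b n m c j := by
    intro j h1 h2
    refine lt_of_le_of_ne (hanti (by omega)) fun heq => ?_
    rcases h1.eq_or_lt with rfl | h1
    · rw [heq, hN3] at hN4; exact lt_irrefl _ hN4
    rcases h2.eq_or_lt with rfl | h2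
    · rw [← heq, hM4] at hM3; exact lt_irrefl _ hM3
    have h3 : breakTime a b n m c j < 1 := (hanti (show N + 1 ≤ j by omega)).trans_lt hN4
    have h4 : 0 < breakTime a b n m c j := hM3.trans_le (hanti h2.le)
    have h5 := hw.coeff_mul_breakTime (c := c) (j := j) (by omega) (by omega)
    have h6 := hw.coeff_mul_breakTime (c := c) (j := j + 1) (by omega) (by omega)
    rw [heq] at h6
    obtain ⟨e, f, hef⟩ := isCoprime_orbitCoeff a b j
    have hef' : (e : ℚ) * orbitCoeff a b j + f * orbitCoeff a b (j + 1) = 1 := by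
      exact_mod_cast hef
    have h7 : breakTime a b n m c j = ((e * c j + f * c (j + 1) : ℤ) : ℚ) := by
      push_cast
      linear_combination (-breakTime a b n m c j) * hef' + e * h5 + f * h6
    rw [h7] at h3 h4
    have h8 : 0 < e * c j + f * c (j + 1) := by exact_mod_cast h4
    have h9 : e * c j + f * c (j + 1) < 1 := by exact_mod_cast h3
    omega
  obtain ⟨s, hs⟩ : ∃ s : ℕ, M + 1 = N + s := ⟨(M + 1 - N).toNat, by omega⟩
  refine ⟨s, fun k => orbitWeight a b (M - k), fun k => breakTime a b n m c (M + 1 - k),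
    ⟨by omega, fun k _ => orbitWeight_mem_orbit a b _, fun k hk => ?_, by simpa using hM4, ?_,
      fun k hk => ?_, fun k hk => ?_⟩,
    hc.isPathOf hw hM2 (by omega) (fun _ _ => rfl) (fun _ _ => rfl) (by simpa using hM4)⟩
  · have e : M - ((k + 1 : ℕ) : ℤ) = M - k - 1 := by push_cast; ring
    simp only [e]
    exact orbitGT_orbitWeight_sub_one ha hb hab (hn.of_mem hm (by omega) (by omega))
      (hn.of_mem hm (by omega) (by omega))
  · rw [hs, add_sub_cancel_right]; exact hN3
  · have e1 : M + 1 - (k : ℤ) = M - k + 1 := by ring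
    have e2 : M + 1 - ((k + 1 : ℕ) : ℤ) = M - k := by push_cast; ring
    simp only [e1, e2]
    exact hlt _ (by omega) (by omega)
  · have e : M - ((k + 1 : ℕ) : ℤ) = M - k - 1 := by push_cast; ring
    have e2 : M + 1 - ((k + 1 : ℕ) : ℤ) = M - k := by push_cast; ring
    simp only [e, e2]
    refine existsSigmaChain_orbitWeight ha hb hab (hn.of_mem hm (by omega) (by omega))
      (hn.of_mem hm (by omega) (by omega)) (hM3.trans_le (hanti (by omega))) (z := c (M - k)) ?_
    rw [mul_comm]
    exact hw.coeff_mul_breakTime (by omega) (by omega)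

/-- Times with the integrality property of breaks come from a sequence of integers. -/
theorem exists_isBreakSeq {a b n m : ℤ} (hw : IsPosWindow a b n m) {τ : ℤ → ℚ} (hτ : Antitone τ)
    (h1 : ∀ j ≤ n, τ j = 1) (h0 : ∀ j, m < j → τ j = 0)
    (hint : ∀ j, n < j → j ≤ m → ∃ z : ℤ, τ j * orbitCoeff a b j = z) :
    ∃ c, IsBreakSeq a b n m c ∧ ∀ j, breakTime a b n m c j = τ j := by
  choose! c hc using hint
  have hpos : ∀ j, n < j → j ≤ m → (0 : ℚ) < orbitCoeff a b j := fun j h2 h3 => by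
    exact_mod_cast hw.pos j h2 h3
  refine ⟨c, ⟨fun j h2 h3 => ?_, fun j h2 h3 => ?_, fun j h2 h3 => ?_⟩, fun j => ?_⟩
  · have h4 : 0 ≤ τ j := by rw [← h0 (m + 1) (by omega)]; exact hτ (by omega)
    have h5 : (0 : ℚ) ≤ c j := by
      rw [← hc j h2 h3]; exact mul_nonneg h4 (hpos j h2 h3).le
    exact_mod_cast h5
  · have h4 : τ j ≤ 1 := by rw [← h1 n le_rfl]; exact hτ h2.le
    have h5 : (c j : ℚ) ≤ orbitCoeff a b j := by
      rw [← hc j h2 h3]; exact mul_le_of_le_one_left (hpos j h2 h3).le h4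
    exact_mod_cast h5
  · have h4 : (c (j + 1) : ℚ) * orbitCoeff a b j ≤ c j * orbitCoeff a b (j + 1) := by
      rw [← hc j h2 h3.le, ← hc (j + 1) (by omega) (by omega)]
      have h5 := mul_le_mul_of_nonneg_right (hτ (show j ≤ j + 1 by omega))
        (mul_pos (hpos j h2 h3.le) (hpos (j + 1) (by omega) (by omega))).le
      linarith
    exact_mod_cast h4
  · rcases le_or_gt j n with h2 | h2
    · rw [breakTime_of_le h2, h1 j h2]
    rcases lt_or_ge m j with h3 | h3
    · rw [hw.breakTime_of_lt h3, h0 j h3]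
    have h4 := hpos j h2 h3
    have h5 := hw.coeff_mul_breakTime (c := c) h2 h3
    rw [← hc j h2 h3, mul_comm] at h5
    exact mul_right_cancel₀ h4.ne' h5

theorem IsLSPair.sigma_monotone {a b : ℤ} {lam : Weight} {s : ℕ} {ν : ℕ → Weight} {σ : ℕ → ℚ}
    (h : IsLSPair a b lam s ν σ) : Monotone fun k => σ (min s k) := by
  refine monotone_nat_of_le_succ fun k => ?_
  rcases lt_or_ge k s with hk | hk
  · rw [min_eq_right hk.le, min_eq_right hk]; exact (h.sigma_lt k hk).le
  · rw [min_eq_left hk, min_eq_left (by omega)]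

theorem IsLSPair.sigma_mem_Ioo {a b : ℤ} {lam : Weight} {s : ℕ} {ν : ℕ → Weight} {σ : ℕ → ℚ}
    (h : IsLSPair a b lam s ν σ) {k : ℕ} (hk : k + 1 < s) : σ (k + 1) ∈ Set.Ioo (0 : ℚ) 1 := by
  have h1 := h.sigma_monotone (Nat.zero_le k)
  have h2 := h.sigma_monotone (show k + 2 ≤ s by omega)
  simp only [Nat.min_zero, min_eq_right (show k ≤ s by omega), h.sigma_zero] at h1
  simp only [min_self, min_eq_right (show k + 2 ≤ s by omega), h.sigma_last] at h2
  exact ⟨h1.trans_lt (h.sigma_lt k (by omega)), (h.sigma_lt (k + 1) hk).trans_le h2⟩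

/-- The directions of a Lakshmibai-Seshadri path are consecutive elements of the orbit. -/
theorem IsLSPair.exists_orbitWeight {a b : ℤ} (ha : 0 < a) (hb : 0 < b) (hab : 4 < a * b)
    {s : ℕ} {ν : ℕ → Weight} {σ : ℕ → ℚ}
    (h : IsLSPair a b (fundamentalWeight 0 - fundamentalWeight 1) s ν σ) :
    ∃ M : ℤ, (∀ k < s, IsOrbitIndex a b (M - k) ∧ ν k = orbitWeight a b (M - k)) ∧
      ∀ k, k + 1 < s → ∃ z : ℤ, σ (k + 1) * orbitCoeff a b (M - k) = z := by
  obtain ⟨M, hM, hM0⟩ := exists_eq_orbitWeight ha hb (h.mem_orbit 0 h.one_le)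
  have step : ∀ k, k + 1 < s → IsOrbitIndex a b (M - k) → ν k = orbitWeight a b (M - k) →
      (IsOrbitIndex a b (M - (k + 1 : ℕ)) ∧ ν (k + 1) = orbitWeight a b (M - (k + 1 : ℕ))) ∧
        ∃ z : ℤ, σ (k + 1) * orbitCoeff a b (M - k) = z := by
    intro k hk h1 h2
    obtain ⟨l, hl, hl'⟩ := exists_eq_orbitWeight ha hb (h.mem_orbit (k + 1) hk)
    have h3 := h.chain k hk
    have h4 := (h.decreasing k hk).2
    rw [h2, hl'] at h3 h4
    obtain ⟨h5, h6⟩ := h.sigma_mem_Ioo hk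
    obtain ⟨rfl, h7⟩ := h3.orbitWeight ha hb hab h1 hl h5 h6 h4
    have e : M - ((k + 1 : ℕ) : ℤ) = M - k - 1 := by push_cast; ring
    rw [e]
    exact ⟨⟨hl, hl'⟩, h7⟩
  have all : ∀ k < s, IsOrbitIndex a b (M - k) ∧ ν k = orbitWeight a b (M - k) := by
    intro k
    induction k with
    | zero => intro _; simpa using ⟨hM, hM0⟩
    | succ k ih =>
      intro hk
      obtain ⟨h1, h2⟩ := ih (by omega)
      exact (step k hk h1 h2).1
  exact ⟨M, all, fun k hk => (step k hk (all k (by omega)).1 (all k (by omega)).2).2⟩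

/-- Every Lakshmibai-Seshadri path has all its directions among `x m, …, x 0` with `m ≥ 0`, or
all among `x 0, …, x n` with `n ≤ 0`: since `p 1 = 1`, there is no break between the directions
`x 1` and `x 0`. -/
theorem exists_windowPath_eq {a b : ℤ} (ha : 0 < a) (hb : 0 < b) (hab : 4 < a * b) {π : Path}
    (hπ : π ∈ LSPaths a b (fundamentalWeight 0 - fundamentalWeight 1)) :
    ∃ n m c, (n = 0 ∨ m = 0) ∧ n ≤ m ∧ IsOrbitIndex a b n ∧ IsOrbitIndex a b m ∧
      IsBreakSeq a b n m c ∧ π = windowPath a b n m c := by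
  obtain ⟨s, ν, σ, h, hpath⟩ := hπ
  obtain ⟨M, hM, hint⟩ := h.exists_orbitWeight ha hb hab
  have hs := h.one_le
  have hM0 : IsOrbitIndex a b M := by simpa using (hM 0 hs).1
  have hN0 : IsOrbitIndex a b (M + 1 - s) := by
    have := (hM (s - 1) (by omega)).1
    rw [Nat.cast_sub hs] at this
    convert this using 1; push_cast; ring
  obtain ⟨n, m, hnm, hn, hm, hnN, hMm⟩ : ∃ n m, (n = 0 ∨ m = 0) ∧ IsOrbitIndex a b n ∧
      IsOrbitIndex a b m ∧ n ≤ M + 1 - s ∧ M ≤ m := by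
    rcases le_or_gt M 0 with h1 | h1
    · exact ⟨M + 1 - s, 0, Or.inr rfl, hN0, isOrbitIndex_zero a b, le_rfl, h1⟩
    refine ⟨0, M, Or.inl rfl, isOrbitIndex_zero a b, hM0, ?_, le_rfl⟩
    by_contra h2
    -- The break between the directions `x 1` and `x 0` would be at an integral time.
    obtain ⟨k, rfl⟩ : ∃ k : ℕ, M = k + 1 := ⟨(M - 1).toNat, by omega⟩
    obtain ⟨z, hz⟩ := hint k (by omega)
    rw [add_sub_cancel_left, orbitCoeff_one, Int.cast_one, mul_one] at hz
    obtain ⟨h5, h6⟩ := h.sigma_mem_Ioo (k := k) (by omega)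
    rw [hz] at h5 h6
    have h7 : 0 < z := by exact_mod_cast h5
    have h8 : z < 1 := by exact_mod_cast h6
    omega
  have hw := IsPosWindow.of_isOrbitIndex ha hb hab (by omega) hn hm
  obtain ⟨c, hc, hcσ⟩ := exists_isBreakSeq hw (τ := fun j => σ (min s (M + 1 - j).toNat))
    (fun i j hij => h.sigma_monotone (by omega))
    (fun j hj => by rw [min_eq_left (by omega), h.sigma_last])
    (fun j hj => by
      rw [Int.toNat_of_nonpos (show M + 1 - j ≤ 0 by omega), Nat.min_zero, h.sigma_zero])
    (fun j h1 h2 => by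
      rcases lt_or_ge M j with h3 | h3
      · exact ⟨0, by
          rw [Int.toNat_of_nonpos (show M + 1 - j ≤ 0 by omega), Nat.min_zero, h.sigma_zero]; simp⟩
      obtain ⟨k, rfl⟩ : ∃ k : ℕ, j = M - k := ⟨(M - j).toNat, by omega⟩
      have e : (M + 1 - (M - k : ℤ)).toNat = k + 1 := by omega
      rw [e]
      rcases lt_or_ge (k + 1) s with h4 | h4
      · rw [min_eq_right h4.le]; exact hint k h4
      · rw [min_eq_left h4, h.sigma_last, one_mul]; exact ⟨_, rfl⟩)
  refine ⟨n, m, c, hnm, hw.le, hn, hm, hc, ?_⟩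
  refine hpath.unique hs h.sigma_zero h.sigma_last (hc.isPathOf hw hMm (by omega)
    (fun k hk => (hM k hk).2) (fun k hk => ?_) h.sigma_zero)
  rw [hcσ]
  have e : (M + 1 - (M + 1 - k : ℤ)).toNat = k := by omega
  simp only [e, min_eq_right hk]

/-! ### Connectedness -/

theorem reachable_of_rootF {a b : ℤ} {lam : Weight} {π π' : LSPaths a b lam} {i : Fin 2}
    (h : rootF a b i π.1 = some π'.1) : (crystalGraph a b lam).Reachable π π' := by
  by_cases hne : π = π'
  · rw [hne]
  · exact SimpleGraph.Adj.reachable ((SimpleGraph.fromRel_adj _ _ _).mpr ⟨hne, Or.inl ⟨i, h⟩⟩)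

/-- The straight path in the direction `Λ₁ - Λ₂`. -/
noncomputable def straightPath (a b : ℤ) : Path := fun t => (t : ℝ) • toReal (orbitWeight a b 0)

theorem straightPath_mem {a b : ℤ} (ha : 0 < a) (hb : 0 < b) (hab : 4 < a * b) :
    straightPath a b ∈ LSPaths a b (fundamentalWeight 0 - fundamentalWeight 1) := by
  have h : IsBreakSeq a b 0 0 0 := ⟨by intros; omega, by intros; omega, by intros; omega⟩
  have h1 := h.windowPath_mem ha hb hab le_rfl (isOrbitIndex_zero a b) (isOrbitIndex_zero a b)
  have h2 : windowPath a b 0 0 0 = straightPath a b := by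
    funext t; simp [windowPath, windowFun, straightPath]
  rwa [h2] at h1

theorem reachable_straightPath_of_left_eq_zero {a b m : ℤ} (ha : 0 < a) (hb : 0 < b)
    (hab : 4 < a * b) (h0 : 0 ≤ m) (hm : IsOrbitIndex a b m) (d : ℕ) {c : ℤ → ℤ}
    (hc : IsBreakSeq a b 0 m c) (hd : ∑ j ∈ Finset.Ioc 0 m, c j = d) :
    (crystalGraph a b (fundamentalWeight 0 - fundamentalWeight 1)).Reachable
      ⟨windowPath a b 0 m c, hc.windowPath_mem ha hb hab h0 (isOrbitIndex_zero a b) hm⟩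
      ⟨straightPath a b, straightPath_mem ha hb hab⟩ := by
  induction d using Nat.strong_induction_on generalizing c with
  | _ d ih =>
    have hw := IsPosWindow.of_isOrbitIndex ha hb hab h0 (isOrbitIndex_zero a b) hm
    by_cases hne : ∃ j, 0 < j ∧ j ≤ m ∧ c j ≠ 0
    · obtain ⟨k, h1, h2, hc', hf⟩ := hc.exists_rootF_sub_single_eq hw (by simp) hne
      have hk : k ∈ Finset.Ioc 0 m := Finset.mem_Ioc.mpr ⟨h1, h2⟩
      have hsum : ∑ j ∈ Finset.Ioc 0 m, (c - Pi.single k 1 : ℤ → ℤ) j = d - 1 := by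
        simp only [Pi.sub_apply, Finset.sum_sub_distrib, hd, Finset.sum_pi_single', hk, if_true]
      have hnn : 0 ≤ ∑ j ∈ Finset.Ioc 0 m, (c - Pi.single k 1 : ℤ → ℤ) j :=
        Finset.sum_nonneg fun j hj => hc'.nonneg j (Finset.mem_Ioc.mp hj).1
          (Finset.mem_Ioc.mp hj).2
      have h3 := ih (d - 1) (by omega) hc' (by omega)
      exact (reachable_of_rootF (i := descent k) (by exact hf)).symm.trans h3
    · push Not at hne
      have h2 : windowPath a b 0 m c = straightPath a b := by
        funext t
        rw [windowPath, windowFun, straightPath, Finset.sum_eq_zero, sub_zero]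
        intro j hj
        rw [Finset.mem_Ioc] at hj
        have : (0 : ℝ) < orbitCoeff a b j := by exact_mod_cast hw.pos j hj.1 hj.2
        rw [hne j hj.1 hj.2, Int.cast_zero, min_eq_right (mul_nonneg this.le t.2.1), zero_smul]
      simp only [h2]
      exact SimpleGraph.Reachable.refl _

theorem reachable_straightPath_of_right_eq_zero {a b n : ℤ} (ha : 0 < a) (hb : 0 < b)
    (hab : 4 < a * b) (h0 : n ≤ 0) (hn : IsOrbitIndex a b n) (d : ℕ) {c : ℤ → ℤ}
    (hc : IsBreakSeq a b n 0 c) (hd : ∑ j ∈ Finset.Ioc n 0, (orbitCoeff a b j - c j) = d) :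
    (crystalGraph a b (fundamentalWeight 0 - fundamentalWeight 1)).Reachable
      ⟨windowPath a b n 0 c, hc.windowPath_mem ha hb hab h0 hn (isOrbitIndex_zero a b)⟩
      ⟨straightPath a b, straightPath_mem ha hb hab⟩ := by
  induction d using Nat.strong_induction_on generalizing c with
  | _ d ih =>
    have hw := IsPosWindow.of_isOrbitIndex ha hb hab h0 hn (isOrbitIndex_zero a b)
    by_cases hne : ∃ j, n < j ∧ j ≤ 0 ∧ c j ≠ orbitCoeff a b j
    · obtain ⟨k, h1, h2, hc', hf⟩ := hc.exists_rootF_eq_add_single hw (by simp) hne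
      have hk : k ∈ Finset.Ioc n 0 := Finset.mem_Ioc.mpr ⟨h1, h2⟩
      have hsum : ∑ j ∈ Finset.Ioc n 0,
          (orbitCoeff a b j - (c + Pi.single k 1 : ℤ → ℤ) j) = d - 1 := by
        simp only [Pi.add_apply, ← sub_sub, Finset.sum_sub_distrib (f := fun j => _ - c j), hd,
          Finset.sum_pi_single', hk, if_true]
      have hnn : 0 ≤ ∑ j ∈ Finset.Ioc n 0, (orbitCoeff a b j - (c + Pi.single k 1 : ℤ → ℤ) j) :=
        Finset.sum_nonneg fun j hj => sub_nonneg.mpr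
          (hc'.le j (Finset.mem_Ioc.mp hj).1 (Finset.mem_Ioc.mp hj).2)
      have h3 := ih (d - 1) (by omega) hc' (by omega)
      exact (reachable_of_rootF (i := descent k) (by exact hf)).trans h3
    · push Not at hne
      have h2 : windowPath a b n 0 c = straightPath a b := by
        funext t
        rw [windowPath, windowFun, straightPath, toReal_orbitWeight_eq_add_sum a b h0, smul_add,
          Finset.smul_sum, add_sub_assoc, add_eq_left, sub_eq_zero]
        refine Finset.sum_congr rfl fun j hj => ?_
        rw [Finset.mem_Ioc] at hj
        have : (0 : ℝ) < orbitCoeff a b j := by exact_mod_cast hw.pos j hj.1 hj.2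
        rw [hne j hj.1 hj.2, min_eq_left (mul_le_of_le_one_right this.le t.2.2), smul_smul,
          mul_comm]
      simp only [h2]
      exact SimpleGraph.Reachable.refl _

end RankTwo

theorem mainTheorem1 (a b : ℤ) (ha : 0 < a) (hb : 0 < b) (hab : 4 < a * b) :
    (RankTwo.crystalGraph a b
      (RankTwo.fundamentalWeight 0 - RankTwo.fundamentalWeight 1)).Connected := by
  rw [SimpleGraph.connected_iff_exists_forall_reachable]
  refine ⟨⟨RankTwo.straightPath a b, RankTwo.straightPath_mem ha hb hab⟩, ?_⟩
  rintro ⟨π, hπ⟩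
  obtain ⟨n, m, c, h | h, hnm, hn, hm, hc, rfl⟩ := RankTwo.exists_windowPath_eq ha hb hab hπ
  · subst h
    obtain ⟨d, hd⟩ := Int.eq_ofNat_of_zero_le (Finset.sum_nonneg fun j hj =>
      hc.nonneg j (Finset.mem_Ioc.mp hj).1 (Finset.mem_Ioc.mp hj).2)
    exact (RankTwo.reachable_straightPath_of_left_eq_zero ha hb hab hnm hm d hc hd).symm
  · subst h
    obtain ⟨d, hd⟩ := Int.eq_ofNat_of_zero_le (Finset.sum_nonneg fun j hj =>
      sub_nonneg.mpr (hc.le j (Finset.mem_Ioc.mp hj).1 (Finset.mem_Ioc.mp hj).2))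
    exact (RankTwo.reachable_straightPath_of_right_eq_zero ha hb hab hnm hn d hc hd).symm
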